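/- A generalised triangulation $\mathcal T$ of dimension $d$ is a set of abstract $d$-simplices (its facets) together with a set of gluings, each of which identifies a pair of distinct $(d-1)$-faces (ridges) affinely, according to a bijection of their vertices, such that each ridge is used in at most one gluing. Its underlying space $|\mathcal T|$ is the resulting quotient space, and $f_i$ denotes the number of its $i$-dimensional faces after identification. Its dual graph is the multigraph with a node for each facet and an arc for each gluing, joining the two facets that are glued together. We say that $\mathcal T$ is a triangulation of the $d$-ball, or of the $d$-sphere, if $|\mathcal T|$ is homeomorphic to the Euclidean unit ball in $\mathbb R^d$, or unit sphere in $\mathbb R^{d+1}$, and PL homeomorphic to the standard PL ball or sphere. Let $d$ and $n$ be positive integers, $d$ odd. Let $B$ be the $\frac{d-1}{2}$ times snapped simplex: a single $d$-simplex with vertices $0,1,\dots,d$ in which, for each $0\le i<\frac{d-1}{2}$, the two ridges opposite the vertices $2i+1$ and $2i$ are glued by $2i\mapsto 2i+1$ and $j\mapsto j$ for all $j\ne 2i,2i+1$. Let $\mathbb S^d_n$ be obtained from $n$ copies of $B$, arranged in a cycle, by gluing the ridge $(0,\dots,d-2,d-1)$ of each copy to the ridge $(0,\dots,d-2,d)$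 of the next copy by $d-1\mapsto d$ and $j\mapsto j$ for $j\le d-2$ (for $n=1$, the next copy is the same copy). Then $B$ is a triangulation of the $d$-ball, and $\mathbb S^d_n$ is a triangulation of the $d$-sphere with $f_d=n$ facets and $f_0=n+\frac{d-1}{2}$ vertices. The dual graph of $\mathbb S^d_n$ is an $n$-gon with $\frac{d-1}{2}$ loops attached to each node, where a $1$-gon is a node with a loop and a $2$-gon consists of two nodes joined by two parallel arcs. -/

import Mathlib

open scoped Graph

/-- A generalised triangulation of dimension `d`: a set of abstract `d`-simplices (facets), each
with vertices labelled by `Fin (d + 1)`, and a set of gluings. The ridge `(Δ, v)` is the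
`(d - 1)`-face of the simplex `Δ` opposite its vertex `v`. A gluing `g` identifies the ridge `src g`
with the ridge `tgt g` affinely, according to the bijection `pairing g` of their vertices.
Injectivity says that no ridge is glued to itself and that each ridge is used in at most one
gluing. -/
structure GenTriangulation (d : ℕ) where
  Facet : Type
  Gluing : Type
  src : Gluing → Facet × Fin (d + 1)
  tgt : Gluing → Facet × Fin (d + 1)
  pairing : ∀ g, {j : Fin (d + 1) // j ≠ (src g).2} ≃ {j : Fin (d + 1) // j ≠ (tgt g).2}
  ridge_injective : Function.Injective (Sum.elim src tgt)

namespace GenTriangulation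

variable {d : ℕ}

/-! ### The underlying space -/

/-- The disjoint union of one standard geometric `d`-simplex for each facet. -/
abbrev Pieces (T : GenTriangulation d) : Type :=
  Σ _ : T.Facet, stdSimplex ℝ (Fin (d + 1))

/-- The point `p` on the ridge `src g` is glued to the point `q` on the ridge `tgt g` when
corresponding vertices have equal barycentric coordinates. -/
def GluedPoints (T : GenTriangulation d) (p q : T.Pieces) : Prop :=
  ∃ g : T.Gluing, p.1 = (T.src g).1 ∧ q.1 = (T.tgt g).1 ∧
    p.2.1 (T.src g).2 = 0 ∧ q.2.1 (T.tgt g).2 = 0 ∧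
    ∀ j : {j : Fin (d + 1) // j ≠ (T.src g).2}, q.2.1 (T.pairing g j) = p.2.1 j

/-- The underlying topological space `|T|`, with the quotient topology. `Quot` takes the quotient
by the equivalence relation generated by the gluings. -/
abbrev Space (T : GenTriangulation d) : Type := Quot T.GluedPoints

/-- The characteristic map of the facet `Δ`. -/
def charMap (T : GenTriangulation d) (Δ : T.Facet) (x : stdSimplex ℝ (Fin (d + 1))) : T.Space :=
  Quot.mk _ ⟨Δ, x⟩

/-! ### Face numbers -/

/-- The `i`-faces of the abstract simplices before gluing. -/
abbrev PreFace (T : GenTriangulation d) (i : ℕ) : Type :=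
  T.Facet × {s : Finset (Fin (d + 1)) // s.card = i + 1}

/-- Two `i`-faces contained in two ridges that are glued together are identified when the gluing
maps the vertices of the one onto the vertices of the other. -/
def GluedFaces (T : GenTriangulation d) (i : ℕ) (p q : T.PreFace i) : Prop :=
  ∃ g : T.Gluing, p.1 = (T.src g).1 ∧ q.1 = (T.tgt g).1 ∧
    (T.src g).2 ∉ p.2.1 ∧ (T.tgt g).2 ∉ q.2.1 ∧
    ∀ j : {j : Fin (d + 1) // j ≠ (T.src g).2}, (T.pairing g j : Fin (d + 1)) ∈ q.2.1 ↔ ↑j ∈ p.2.1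

/-- The number `f_i` of `i`-dimensional faces of `T`, that is, of `i`-faces after identification. -/
noncomputable def fNumber (T : GenTriangulation d) (i : ℕ) : ℕ :=
  Nat.card (Quot (T.GluedFaces i))

/-! ### The dual graph -/

/-- The dual graph: a multigraph with one node for each facet and one arc for each gluing, which
links the two facets that are being glued. -/
def dualGraph (T : GenTriangulation d) : Graph T.Facet T.Gluing where
  vertexSet := Set.univ
  IsLink g x y := s((T.src g).1, (T.tgt g).1) = s(x, y)
  isLink_symm := fun _ _ => ⟨fun _ _ h => h.trans Sym2.eq_swap⟩
  eq_or_eq_of_isLink_of_isLink := by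
    intro g x y v w h h'
    rcases Sym2.eq_iff.1 (h.symm.trans h') with h | h
    · exact Or.inl h.1
    · exact Or.inr h.1
  left_mem_of_isLink := fun _ _ _ _ => Set.mem_univ _

/-! ### Snapped balls and gluing in a cycle -/

/-- The pairing of the vertices of the ridge opposite `b` with those of the ridge opposite `a` that
maps `a` to `b` and every other vertex to the vertex with the same label. -/
def fold (a b : Fin (d + 1)) : {j : Fin (d + 1) // j ≠ b} ≃ {j : Fin (d + 1) // j ≠ a} :=
  (Equiv.swap a b).subtypeEquiv fun j => not_congr (by
    rw [Equiv.swap_apply_eq_iff, Equiv.swap_apply_left])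

/-- The `k` times snapped `d`-ball: a single `d`-simplex with vertices `0, …, d`, in which for each
`i < k` the two ridges opposite the vertices `2i + 1` and `2i` are glued by folding over their
common `(d - 2)`-face: `2i ↦ 2i + 1`, and every other vertex is mapped to itself. -/
def snappedBall (d k : ℕ) (hk : 2 * k ≤ d) : GenTriangulation d where
  Facet := Unit
  Gluing := Fin k
  src i := ((), ⟨2 * i + 1, by omega⟩)
  tgt i := ((), ⟨2 * i, by omega⟩)
  pairing i := fold ⟨2 * i, by omega⟩ ⟨2 * i + 1, by omega⟩
  ridge_injective := by
    rintro (a | a) (b | b) h <;> simp [Prod.ext_iff, Fin.ext_iff] at h ⊢ <;> omega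

/-- Take `n` copies of the triangulation `B`, indexed cyclically, and glue the ridge `r` of each
copy to the ridge `s` of the next copy, according to the bijection `e` of their vertices. Here `r`
and `s` are distinct boundary ridges of `B`. (If `n = 1`, then `r` is glued to `s` in `B`.) -/
def glueInCycle (B : GenTriangulation d) (n : ℕ) (r s : B.Facet × Fin (d + 1))
    (hr : r ∉ Set.range (Sum.elim B.src B.tgt)) (hs : s ∉ Set.range (Sum.elim B.src B.tgt))
    (hrs : r ≠ s) (e : {j : Fin (d + 1) // j ≠ r.2} ≃ {j : Fin (d + 1) // j ≠ s.2}) :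
    GenTriangulation d where
  Facet := Fin n × B.Facet
  Gluing := (Fin n × B.Gluing) ⊕ Fin n
  src := Sum.elim (fun p => ((p.1, (B.src p.2).1), (B.src p.2).2)) (fun c => ((c, r.1), r.2))
  tgt := Sum.elim (fun p => ((p.1, (B.tgt p.2).1), (B.tgt p.2).2))
    (fun c => ((finRotate n c, s.1), s.2))
  pairing := fun g => match g with
    | Sum.inl p => B.pairing p.2
    | Sum.inr _ => e
  ridge_injective := by
    have hB := B.ridge_injective
    have h1 : ∀ g, B.src g ≠ r := fun g h => hr ⟨Sum.inl g, h⟩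
    have h2 : ∀ g, B.tgt g ≠ r := fun g h => hr ⟨Sum.inr g, h⟩
    have h3 : ∀ g, B.src g ≠ s := fun g h => hs ⟨Sum.inl g, h⟩
    have h4 : ∀ g, B.tgt g ≠ s := fun g h => hs ⟨Sum.inr g, h⟩
    have h5 : ∀ g g', B.src g = B.src g' → g = g' := fun g g' h => by
      have := @hB (Sum.inl g) (Sum.inl g') h
      simpa using this
    have h6 : ∀ g g', B.tgt g = B.tgt g' → g = g' := fun g g' h => by
      have := @hB (Sum.inr g) (Sum.inr g') h
      simpa using this
    have h7 : ∀ g g', B.src g ≠ B.tgt g' := fun g g' h => by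
      have := @hB (Sum.inl g) (Sum.inr g') h
      simp at this
    rintro ((a | a) | (a | a)) ((b | b) | (b | b)) h <;>
      simp only [Sum.elim_inl, Sum.elim_inr, Prod.mk.injEq] at h <;>
      obtain ⟨⟨ha, hb⟩, hc⟩ := h
    · rw [Prod.ext ha (h5 _ _ (Prod.ext hb hc))]
    · exact (h1 _ (Prod.ext hb hc)).elim
    · exact (h7 _ _ (Prod.ext hb hc)).elim
    · exact (h3 _ (Prod.ext hb hc)).elim
    · exact (h1 _ (Prod.ext hb.symm hc.symm)).elim
    · rw [ha]
    · exact (h2 _ (Prod.ext hb.symm hc.symm)).elim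
    · exact (hrs (Prod.ext hb hc)).elim
    · exact (h7 _ _ (Prod.ext hb.symm hc.symm)).elim
    · exact (h2 _ (Prod.ext hb hc)).elim
    · rw [Prod.ext ha (h6 _ _ (Prod.ext hb hc))]
    · exact (h4 _ (Prod.ext hb hc)).elim
    · exact (h3 _ (Prod.ext hb.symm hc.symm)).elim
    · exact (hrs (Prod.ext hb.symm hc.symm)).elim
    · exact (h4 _ (Prod.ext hb.symm hc.symm)).elim
    · rw [(finRotate n).injective ha]

/-- For `d` odd: `n` copies of the `(d - 1) / 2` times snapped `d`-ball, glued in a cycle. The ridge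
`(0, …, d - 2, d - 1)` opposite `d` of each copy is glued to the ridge `(0, …, d - 2, d)` opposite
`d - 1` of the next copy, by `d - 1 ↦ d` and the identity on the vertices `0, …, d - 2`. -/
def snappedSphere (d n : ℕ) (hd : Odd d) : GenTriangulation d :=
  (snappedBall d ((d - 1) / 2) (by omega)).glueInCycle n
    ((), ⟨d, by omega⟩) ((), ⟨d - 1, by omega⟩)
    (by
      obtain ⟨m, hm⟩ := hd
      rintro ⟨(i : Fin ((d - 1) / 2)) | (i : Fin ((d - 1) / 2)), h⟩
      · have h' : 2 * (i : ℕ) + 1 = d := congrArg (fun r => (r.2 : ℕ)) h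
        omega
      · have h' : 2 * (i : ℕ) = d := congrArg (fun r => (r.2 : ℕ)) h
        omega)
    (by
      obtain ⟨m, hm⟩ := hd
      rintro ⟨(i : Fin ((d - 1) / 2)) | (i : Fin ((d - 1) / 2)), h⟩
      · have h' : 2 * (i : ℕ) + 1 = d - 1 := congrArg (fun r => (r.2 : ℕ)) h
        omega
      · have h' : 2 * (i : ℕ) = d - 1 := congrArg (fun r => (r.2 : ℕ)) h
        omega)
    (fun h => by
      have := hd.pos
      have h' : d = d - 1 := congrArg (fun r => (r.2 : ℕ)) h
      omega)
    (fold ⟨d - 1, by omega⟩ ⟨d, by omega⟩)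

end GenTriangulation

/-! ### Multigraphs -/

/-- Isomorphism of multigraphs: compatible bijections of the nodes and of the arcs. -/
def GraphIsomorphic {V A V' A' : Type*} (G : Graph V A) (H : Graph V' A') : Prop :=
  ∃ (φ : V(G) ≃ V(H)) (ψ : E(G) ≃ E(H)), ∀ (e : E(G)) (x y : V(G)),
    G.IsLink e x y ↔ H.IsLink (ψ e) (φ x) (φ y)

/-- The `n`-gon with `l` loops attached to each node, as a multigraph: the arc `inl c` links `c` to
the cyclically next node, and `inr (c, i)` is the `i`-th loop at `c`. The `1`-gon is a single node
with a loop, and the `2`-gon has two nodes and two parallel arcs. -/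
def loopedPolygon (n l : ℕ) : Graph (Fin n) (Fin n ⊕ (Fin n × Fin l)) where
  vertexSet := Set.univ
  IsLink e x y := match e with
    | Sum.inl c => s(c, finRotate n c) = s(x, y)
    | Sum.inr p => s(p.1, p.1) = s(x, y)
  isLink_symm := by
    rintro (c | p) - <;> exact ⟨fun _ _ h => h.trans Sym2.eq_swap⟩
  eq_or_eq_of_isLink_of_isLink := by
    rintro (c | p) x y v w h h' <;>
    · rcases Sym2.eq_iff.1 (h.symm.trans h') with h | h
      · exact Or.inl h.1
      · exact Or.inr h.1
  left_mem_of_isLink := fun _ _ _ _ => Set.mem_univ _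

/-! ### Piecewise linear balls and spheres -/

/-- A closed convex polyhedron: a finite intersection of closed half-spaces. -/
def IsConvexPolyhedron {E : Type*} [AddCommGroup E] [Module ℝ E] (C : Set E) : Prop :=
  ∃ L : Set (E →ᵃ[ℝ] ℝ), L.Finite ∧ C = {x | ∀ l ∈ L, 0 ≤ l x}

/-- A map `f : X → F` is piecewise linear if `X` is covered by finitely many closed convex
polyhedra, on each of which `f` is the restriction of an affine map. -/
def IsPiecewiseLinear {E F : Type*} [AddCommGroup E] [Module ℝ E] [AddCommGroup F] [Module ℝ F]
    {X : Set E} (f : X → F) : Prop :=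
  ∃ P : Set (Set E), P.Finite ∧ (∀ C ∈ P, IsConvexPolyhedron C) ∧ X ⊆ ⋃₀ P ∧
    ∀ C ∈ P, ∃ A : E →ᵃ[ℝ] F, ∀ x : X, (x : E) ∈ C → f x = A x

/-- `|T|` is PL homeomorphic to the polyhedron `Y ⊆ ℝ^N`: there is a homeomorphism whose
composition with the characteristic map of each facet is piecewise linear on that simplex. -/
def GenTriangulation.PLHomeomorphic {d N : ℕ} (T : GenTriangulation d)
    (Y : Set (Fin N → ℝ)) : Prop :=
  ∃ h : T.Space ≃ₜ Y, ∀ Δ : T.Facet,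
    IsPiecewiseLinear (fun x : stdSimplex ℝ (Fin (d + 1)) => (h (T.charMap Δ x) : Fin N → ℝ))

/-- The standard PL `d`-ball, modelled as the `d`-dimensional cross-polytope. -/
def plBall (d : ℕ) : Set (Fin d → ℝ) := {x | ∑ i, |x i| ≤ 1}

/-- The standard PL `d`-sphere, modelled as the boundary of the `(d + 1)`-dimensional
cross-polytope. -/
def plSphere (d : ℕ) : Set (Fin (d + 1) → ℝ) := {x | ∑ i, |x i| = 1}

/-- `T` is a triangulation of the `d`-ball: `|T|` is homeomorphic to the Euclidean unit ball, and PL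
homeomorphic to the standard PL ball. -/
def GenTriangulation.IsTriangulationOfBall {d : ℕ} (T : GenTriangulation d) : Prop :=
  Nonempty (T.Space ≃ₜ Metric.closedBall (0 : EuclideanSpace ℝ (Fin d)) 1) ∧
    T.PLHomeomorphic (plBall d)

/-- `T` is a triangulation of the `d`-sphere: `|T|` is homeomorphic to the Euclidean unit sphere,
and PL homeomorphic to the standard PL sphere. -/
def GenTriangulation.IsTriangulationOfSphere {d : ℕ} (T : GenTriangulation d) : Prop :=
  Nonempty (T.Space ≃ₜ Metric.sphere (0 : EuclideanSpace ℝ (Fin (d + 1))) 1) ∧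
    T.PLHomeomorphic (plSphere d)

/-! Write d = 2k + 1 and group the barycentric coordinates of a d-simplex into k + 1 consecutive
pairs, so that the simplex becomes the join of k + 1 edges. Folding the ridges opposite 2i + 1 and
2i identifies (a, 0) with (0, a) in the i-th pair and leaves all other coordinates alone. The
quadrant of such pairs, with its two sides glued, is a plane: send (a, b) to the point at position
4a on the ℓ¹-circle of radius a + b, parametrised from (s, 0) through (0, s), (-s, 0), (0, -s) back
to (s, 0) by `circleX` and `circleY`. This map preserves the ℓ¹-norm and is built from affine maps
and absolute values, hence is piecewise linear.

For the ball, the last pair (a, b) is sent to a - b. The ℓ¹-norm of the image is then at most 1, and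
because the planar coordinates determine a + b, nothing further is identified: the quotient is the
d-dimensional cross-polytope. For the sphere, the last pairs of the n copies form n quadrants glued
cyclically along their sides with a common apex, again a plane. `sectorPos` lays the c-th quadrant
on the c-th arc of length 4(a + b)/n, so that the total ℓ¹-norm is exactly 1 and the quotient is the
boundary of the (d + 1)-dimensional cross-polytope, a join of k + 1 circles.

`pair_injective` and `sector_injective` show that the planar maps identify no more than the gluings
do; `charMap_eq_of_pairRel` combines the identifications of separate pairs into one of the whole
simplex. `exists_homeomorph_of_charMap` then turns the maps into homeomorphisms by compactness, and
`exists_homeomorph_image_plBall` passes from cross-polytopes to round balls and spheres.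

A facet lies in no ridge, so f_d = n. Among vertices, the folds merge 2i with 2i + 1, the cyclic
gluings merge these over all copies (k classes), and vertex d - 1 of each copy is merged with vertex
d of the next (n classes). -/

/-! ### Wrapping a quadrant around the plane -/

/-- First coordinate of the point at position `t ∈ [0, 4 s]` on the `ℓ¹`-circle of radius `s`. -/
def circleX (s t : ℝ) : ℝ := |t - 2 * s| - s

/-- Second coordinate of the point at position `t ∈ [0, 4 s]` on the `ℓ¹`-circle of radius `s`. -/
def circleY (s t : ℝ) : ℝ := t - 2 * s - |t - s| + |t - 3 * s|

theorem abs_circleX_add_abs_circleY {s t : ℝ} (h0 : 0 ≤ t) (h1 : t ≤ 4 * s) :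
    |circleX s t| + |circleY s t| = s := by
  unfold circleX circleY
  rcases abs_cases (t - 2 * s) with h | h <;> rcases abs_cases (t - s) with h' | h' <;>
  rcases abs_cases (t - 3 * s) with h'' | h'' <;> rw [h.1, h'.1, h''.1] <;>
  simp only [abs_eq_max_neg] <;> grind

theorem circle_zero {s : ℝ} (hs : 0 ≤ s) : circleX s 0 = s ∧ circleY s 0 = 0 := by
  unfold circleX circleY
  constructor <;> grind

theorem circle_four_mul {s : ℝ} (hs : 0 ≤ s) : circleX s (4 * s) = s ∧ circleY s (4 * s) = 0 := by
  unfold circleX circleY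
  constructor <;> grind

/-- The radius is the ℓ¹-norm of the point; on a fixed circle only the two ends of the parameter
interval coincide. -/
theorem circle_injective {s t s' t' : ℝ} (h0 : 0 ≤ t) (h1 : t ≤ 4 * s) (h0' : 0 ≤ t')
    (h1' : t' ≤ 4 * s') (hX : circleX s t = circleX s' t') (hY : circleY s t = circleY s' t') :
    s = s' ∧ (t = t' ∨ (t = 0 ∧ t' = 4 * s) ∨ (t = 4 * s ∧ t' = 0)) := by
  have hs : s = s' := by
    rw [← abs_circleX_add_abs_circleY h0 h1, ← abs_circleX_add_abs_circleY h0' h1', hX, hY]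
  subst hs
  refine ⟨rfl, ?_⟩
  unfold circleX at hX
  unfold circleY at hY
  have h : |t - 2 * s| = |t' - 2 * s| := by linarith
  rcases abs_eq_abs.1 h with h | h
  · left; linarith
  -- The first coordinate is even and the second odd under t ↦ 4s - t, so the second must vanish,
  -- leaving t = 0, 2s or 4s.
  · have ht : t' = 4 * s - t := by linarith
    subst ht
    rcases abs_cases (t - s) with a | a <;> rcases abs_cases (t - 3 * s) with b | b <;>
    rcases abs_cases (4 * s - t - s) with a' | a' <;>
    rcases abs_cases (4 * s - t - 3 * s) with b' | b' <;> rw [a.1, b.1, a'.1, b'.1] at hY <;> grind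

theorem circle_surjective (x y : ℝ) :
    ∃ t, 0 ≤ t ∧ t ≤ 4 * (|x| + |y|) ∧ circleX (|x| + |y|) t = x ∧ circleY (|x| + |y|) t = y := by
  unfold circleX circleY
  rcases le_total 0 y with hy | hy
  -- On the upper half of the circle of radius s the first coordinate is s - t, on the lower half it
  -- is t - 3s.
  · refine ⟨|x| + |y| - x, ?_, ?_, ?_, ?_⟩ <;> grind
  · refine ⟨3 * (|x| + |y|) + x, ?_, ?_, ?_, ?_⟩ <;> grind

theorem pair_injective {a b a' b' : ℝ} (ha : 0 ≤ a) (hb : 0 ≤ b) (ha' : 0 ≤ a') (hb' : 0 ≤ b')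
    (hX : circleX (a + b) (4 * a) = circleX (a' + b') (4 * a'))
    (hY : circleY (a + b) (4 * a) = circleY (a' + b') (4 * a')) :
    (a = a' ∧ b = b') ∨ ((a = 0 ∨ b = 0) ∧ a = b' ∧ b = a') := by
  have := circle_injective (by linarith) (by linarith) (by linarith) (by linarith) hX hY
  grind

theorem pair_surjective (x y : ℝ) :
    ∃ a b, 0 ≤ a ∧ 0 ≤ b ∧ a + b = |x| + |y| ∧ circleX (a + b) (4 * a) = x ∧
      circleY (a + b) (4 * a) = y := by
  obtain ⟨t, h0, h1, hx, hy⟩ := circle_surjective x y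
  refine ⟨t / 4, |x| + |y| - t / 4, by linarith, by linarith, by ring, ?_, ?_⟩
  · convert hx using 2 <;> ring
  · convert hy using 2 <;> ring

/-- The position on the `ℓ¹`-circle of radius `a + b` of the point `(a, b)` of the `c`-th of `n`
quadrants arranged in a cycle. -/
noncomputable def sectorPos (n : ℕ) (c : ℕ) (a b : ℝ) : ℝ := 4 * (c * (a + b) + a) / n

theorem sectorPos_nonneg {n c : ℕ} {a b : ℝ} (ha : 0 ≤ a) (hb : 0 ≤ b) : 0 ≤ sectorPos n c a b := by
  unfold sectorPos; positivity

theorem sectorPos_le {n c : ℕ} (hc : c < n) {a b : ℝ} (ha : 0 ≤ a) (hb : 0 ≤ b) :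
    sectorPos n c a b ≤ 4 * (a + b) := by
  have hn : (0 : ℝ) < n := by exact_mod_cast (by omega : 0 < n)
  have hc' : (c : ℝ) + 1 ≤ n := by exact_mod_cast hc
  unfold sectorPos
  rw [div_le_iff₀ hn]
  nlinarith [mul_le_mul_of_nonneg_right hc' (by positivity : 0 ≤ a + b)]

/-- The intervals [cs, (c + 1)s] overlap only at endpoints of consecutive ones. -/
theorem sector_step {n : ℕ} {s : ℝ} (hs : 0 < s) {c c' : ℕ} {a a' : ℝ} (ha : 0 ≤ a) (has : a ≤ s)
    (ha' : 0 ≤ a') (has' : a' ≤ s) (h : c * s + a = c' * s + a') (hc : c < n) (hc' : c' < n) :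
    (c = c' ∧ a = a') ∨ (c' = c + 1 ∧ a = s ∧ a' = 0) ∨ (c = c' + 1 ∧ a' = s ∧ a = 0) := by
  rcases lt_trichotomy c c' with hlt | rfl | hlt
  · right; left
    have h1 : ((c' : ℝ) - c) * s ≤ 1 * s := by linarith
    have h2 := le_of_mul_le_mul_right h1 hs
    have h3 : c' ≤ c + 1 := by
      have : (c' : ℝ) ≤ c + 1 := by linarith
      exact_mod_cast this
    have h4 : c' = c + 1 := by omega
    subst h4
    push_cast at h
    exact ⟨rfl, by linarith, by linarith⟩
  · left; exact ⟨rfl, by linarith⟩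
  · right; right
    have h1 : ((c : ℝ) - c') * s ≤ 1 * s := by linarith
    have h2 := le_of_mul_le_mul_right h1 hs
    have h3 : c ≤ c' + 1 := by
      have : (c : ℝ) ≤ c' + 1 := by linarith
      exact_mod_cast this
    have h4 : c = c' + 1 := by omega
    subst h4
    push_cast at h
    exact ⟨rfl, by linarith, by linarith⟩

/-- Where the circle closes up: position 0 is the start of sector 0, and position ns is the end of
sector n - 1. -/
theorem sector_ends {n : ℕ} {s : ℝ} (hs : 0 < s) {c c' : ℕ} {a a' : ℝ} (ha : 0 ≤ a)
    (has' : a' ≤ s) (h : c * s + a = 0) (h' : c' * s + a' = n * s)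
    (hc' : c' < n) : c = 0 ∧ a = 0 ∧ c' + 1 = n ∧ a' = s := by
  have hc0 : 0 ≤ (c : ℝ) * s := by positivity
  have h1 : (c : ℝ) * s = 0 := by linarith
  have h2 : c = 0 := by
    rcases mul_eq_zero.1 h1 with h | h
    · exact_mod_cast h
    · exact absurd h hs.ne'
  have h3 : (n : ℝ) * s ≤ (c' + 1) * s := by linarith
  have h4 := le_of_mul_le_mul_right h3 hs
  have h5 : n = c' + 1 := by
    have : n ≤ c' + 1 := by exact_mod_cast h4
    omega
  subst h5
  push_cast at h'
  exact ⟨h2, by linarith, rfl, by linarith⟩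

/-- Two points of the cycle of quadrants have the same image in the plane only if they are equal,
both are apices, or they lie on the common side of two consecutive quadrants. -/
theorem sector_injective {n : ℕ} {c c' : Fin n} {a b a' b' : ℝ} (ha : 0 ≤ a)
    (hb : 0 ≤ b) (ha' : 0 ≤ a') (hb' : 0 ≤ b')
    (hX : circleX (a + b) (sectorPos n c a b) = circleX (a' + b') (sectorPos n c' a' b'))
    (hY : circleY (a + b) (sectorPos n c a b) = circleY (a' + b') (sectorPos n c' a' b')) :
    (c = c' ∧ a = a' ∧ b = b') ∨ (a = 0 ∧ b = 0 ∧ a' = 0 ∧ b' = 0) ∨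
      (c' = finRotate n c ∧ b = 0 ∧ a' = 0 ∧ a = b') ∨
      (c = finRotate n c' ∧ b' = 0 ∧ a = 0 ∧ a' = b) := by
  obtain ⟨m, rfl⟩ : ∃ m, n = m + 1 := ⟨n - 1, by have := c.2; omega⟩
  have hn : ((m + 1 : ℕ) : ℝ) ≠ 0 := by positivity
  obtain ⟨hs, h⟩ := circle_injective (sectorPos_nonneg ha hb) (sectorPos_le c.2 ha hb)
    (sectorPos_nonneg ha' hb') (sectorPos_le c'.2 ha' hb') hX hY
  rcases (add_nonneg ha hb).eq_or_lt with h0 | h0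
  · right; left
    refine ⟨?_, ?_, ?_, ?_⟩ <;> linarith
  unfold sectorPos at h
  rw [← hs] at h
  obtain ⟨s, hab⟩ : ∃ s, a + b = s := ⟨_, rfl⟩
  rw [hab] at hs h h0
  clear hX hY
  have has : a ≤ s := by linarith
  have has' : a' ≤ s := by linarith
  have rot : ∀ x y : Fin (m + 1), (y : ℕ) = x + 1 → y = finRotate (m + 1) x := by
    intro x y hxy
    rw [finRotate_apply]
    apply Fin.ext
    rw [Fin.val_add_one_of_lt' (by omega), hxy]
  have rot' : ∀ x y : Fin (m + 1), (y : ℕ) = 0 → (x : ℕ) + 1 = m + 1 → y = finRotate (m + 1) x := by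
    intro x y hy hx
    rw [finRotate_apply]
    have : x = Fin.last m := Fin.ext (by simpa using hx)
    subst this
    exact Fin.ext (by simpa using hy)
  -- Either the positions agree, so that the sectors are equal or adjacent, or one is 0 and the
  -- other a full turn, so that the first and last sectors meet.
  rcases h with h | ⟨h, h'⟩ | ⟨h, h'⟩
  · have h2 : (c : ℕ) * s + a = (c' : ℕ) * s + a' := by
      field_simp at h; linarith
    rcases sector_step h0 ha has ha' has' h2 c.2 c'.2 with h | h | h
    · left; exact ⟨Fin.ext h.1, h.2, by linarith⟩
    · right; right; left; exact ⟨rot _ _ h.1, by linarith, h.2.2, by linarith⟩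
    · right; right; right; exact ⟨rot _ _ h.1, by linarith, h.2.2, by linarith⟩
  · have h2 : (c : ℕ) * s + a = 0 := by field_simp at h; linarith
    have h3 : (c' : ℕ) * s + a' = (m + 1 : ℕ) * s := by field_simp at h'; linarith
    have := sector_ends h0 ha has' h2 h3 c'.2
    right; right; right; exact ⟨rot' _ _ this.1 this.2.2.1, by linarith, this.2.1, by linarith⟩
  · have h2 : (c' : ℕ) * s + a' = 0 := by field_simp at h'; linarith
    have h3 : (c : ℕ) * s + a = (m + 1 : ℕ) * s := by field_simp at h; linarith
    have := sector_ends h0 ha' has h2 h3 c.2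
    right; right; left; exact ⟨rot' _ _ this.1 this.2.2.1, by linarith, this.2.1, by linarith⟩

theorem sector_surjective {n : ℕ} (hn : 0 < n) (x y : ℝ) :
    ∃ (c : Fin n) (a b : ℝ), 0 ≤ a ∧ 0 ≤ b ∧ a + b = |x| + |y| ∧
      circleX (a + b) (sectorPos n c a b) = x ∧ circleY (a + b) (sectorPos n c a b) = y := by
  obtain ⟨t, h0, h1, hx, hy⟩ := circle_surjective x y
  have hn' : (0 : ℝ) < n := by exact_mod_cast hn
  suffices H : ∃ (c : Fin n) (a : ℝ), 0 ≤ a ∧ a ≤ |x| + |y| ∧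
      (c : ℕ) * (|x| + |y|) + a = n * t / 4 by
    obtain ⟨c, a, h2, h3, h4⟩ := H
    have h5 : sectorPos n c a (|x| + |y| - a) = t := by
      unfold sectorPos
      rw [add_sub_cancel, h4]
      field_simp
    refine ⟨c, a, |x| + |y| - a, h2, by linarith, by ring, ?_, ?_⟩
    · rw [h5, add_sub_cancel, hx]
    · rw [h5, add_sub_cancel, hy]
  generalize |x| + |y| = s at *
  clear hx hy
  rcases (show 0 ≤ s by linarith).eq_or_lt with h | h
  · subst h
    exact ⟨⟨0, hn⟩, 0, le_rfl, le_rfl, by rw [show t = 0 by linarith]; simp⟩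
  -- The sector is the integer part of nt/(4s). The endpoint t = 4s would give sector n, so it is
  -- assigned to the end of sector n - 1 instead.
  · have hq : 0 ≤ n * t / 4 / s := by positivity
    by_cases hlt : ⌊n * t / 4 / s⌋₊ < n
    · refine ⟨⟨_, hlt⟩, n * t / 4 - ⌊n * t / 4 / s⌋₊ * s, ?_, ?_, by simp⟩
      · have := Nat.floor_le hq
        rw [le_div_iff₀ h] at this
        linarith
      · have := (Nat.lt_floor_add_one (n * t / 4 / s)).le
        rw [div_le_iff₀ h] at this
        linarith
    · have h2 : (n : ℝ) ≤ n * t / 4 / s := (Nat.le_floor_iff hq).1 (not_lt.1 hlt)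
      rw [le_div_iff₀ h] at h2
      have h3 : n * t / 4 = n * s := by
        apply le_antisymm _ h2
        nlinarith
      refine ⟨⟨n - 1, by omega⟩, s, h.le, le_rfl, ?_⟩
      rw [h3]
      push_cast [Nat.cast_sub (show 1 ≤ n from hn)]
      ring

theorem sectorPos_finRotate {n : ℕ} (c : Fin n) {a : ℝ} (ha : 0 ≤ a) :
    circleX a (sectorPos n c a 0) = circleX a (sectorPos n (finRotate n c) 0 a) ∧
    circleY a (sectorPos n c a 0) = circleY a (sectorPos n (finRotate n c) 0 a) := by
  obtain ⟨m, rfl⟩ : ∃ m, n = m + 1 := ⟨n - 1, by have := c.2; omega⟩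
  rw [finRotate_apply]
  rcases eq_or_ne c (Fin.last m) with rfl | hc
  · have h1 : sectorPos (m + 1) (Fin.last m : Fin (m + 1)) a 0 = 4 * a := by
      unfold sectorPos
      rw [Fin.val_last]
      push_cast
      field_simp
      ring
    have h2 : sectorPos (m + 1) ((Fin.last m + 1 : Fin (m + 1)) : ℕ) 0 a = 0 := by
      simp [sectorPos]
    rw [h1, h2, (circle_zero ha).1, (circle_zero ha).2, (circle_four_mul ha).1,
      (circle_four_mul ha).2]
    exact ⟨rfl, rfl⟩
  · have h1 : sectorPos (m + 1) c a 0 = sectorPos (m + 1) ((c + 1 : Fin (m + 1)) : ℕ) 0 a := by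
      unfold sectorPos
      rw [Fin.val_add_one_of_lt (Fin.lt_last_iff_ne_last.2 hc)]
      push_cast
      ring
    rw [h1]
    exact ⟨rfl, rfl⟩

/-! ### Closure properties of piecewise linear maps -/

section PiecewiseLinear

variable {E : Type*} [AddCommGroup E] [Module ℝ E]

theorem IsConvexPolyhedron.iInter {ι : Type*} [Finite ι] {C : ι → Set E}
    (h : ∀ i, IsConvexPolyhedron (C i)) : IsConvexPolyhedron (⋂ i, C i) := by
  choose L hL hC using h
  refine ⟨⋃ i, L i, Set.finite_iUnion hL, ?_⟩
  ext x
  simp only [Set.mem_iInter, Set.mem_iUnion, Set.mem_ofPred_eq]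
  constructor
  · rintro hx l ⟨i, hl⟩
    have := hx i
    rw [hC i] at this
    exact this l hl
  · intro hx i
    rw [hC i]
    exact fun l hl => hx l ⟨i, hl⟩

theorem IsConvexPolyhedron.inter_halfSpace {C : Set E} (h : IsConvexPolyhedron C)
    (l : E →ᵃ[ℝ] ℝ) : IsConvexPolyhedron (C ∩ {x | 0 ≤ l x}) := by
  obtain ⟨L, hL, rfl⟩ := h
  refine ⟨insert l L, hL.insert l, ?_⟩
  ext x
  simp [and_comm]

variable {X : Set E}

theorem IsPiecewiseLinear.of_affine {F : Type*} [AddCommGroup F] [Module ℝ F] (A : E →ᵃ[ℝ] F) :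
    IsPiecewiseLinear (fun x : X => A x) :=
  ⟨{Set.univ}, Set.finite_singleton _, by rintro C rfl; exact ⟨∅, Set.finite_empty, by simp⟩,
    by simp, by rintro C -; exact ⟨A, fun _ _ => rfl⟩⟩

theorem IsPiecewiseLinear.affine_comp {F G : Type*} [AddCommGroup F] [Module ℝ F] [AddCommGroup G]
    [Module ℝ G] (A : F →ᵃ[ℝ] G) {f : X → F} (hf : IsPiecewiseLinear f) :
    IsPiecewiseLinear (fun x => A (f x)) := by
  obtain ⟨P, h1, h2, h3, h4⟩ := hf
  refine ⟨P, h1, h2, h3, fun C hC => ?_⟩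
  obtain ⟨B, hB⟩ := h4 C hC
  exact ⟨A.comp B, fun x hx => by simp [hB x hx]⟩

/-- The common refinement of the coordinatewise covers works, since a finite intersection of
polyhedra is a polyhedron. -/
theorem IsPiecewiseLinear.pi {ι : Type*} [Finite ι] {f : X → ι → ℝ}
    (hf : ∀ i, IsPiecewiseLinear (fun x => f x i)) : IsPiecewiseLinear f := by
  choose P h1 h2 h3 h4 using hf
  refine ⟨(fun C : ι → Set E => ⋂ i, C i) '' Set.univ.pi P, (Set.Finite.pi' h1).subset ?_ |>.image _,
    ?_, ?_, ?_⟩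
  · intro C hC i
    exact hC i trivial
  · rintro _ ⟨C, hC, rfl⟩
    exact IsConvexPolyhedron.iInter fun i => h2 i _ (hC i trivial)
  · intro x hx
    choose C hC hxC using fun i => h3 i hx
    exact ⟨_, ⟨C, fun i _ => hC i, rfl⟩, Set.mem_iInter.2 hxC⟩
  · rintro _ ⟨C, hC, rfl⟩
    choose A hA using fun i => h4 i _ (hC i trivial)
    refine ⟨AffineMap.pi A, fun x hx => ?_⟩
    funext i
    exact hA i x (Set.mem_iInter.1 hx i)

theorem IsPiecewiseLinear.add {f g : X → ℝ} (hf : IsPiecewiseLinear f)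
    (hg : IsPiecewiseLinear g) : IsPiecewiseLinear (fun x => f x + g x) := by
  have h : IsPiecewiseLinear (fun x => ![f x, g x]) := IsPiecewiseLinear.pi fun i => by
    fin_cases i
    · exact hf
    · exact hg
  exact h.affine_comp
    (LinearMap.proj (R := ℝ) (φ := fun _ : Fin 2 => ℝ) 0 + LinearMap.proj 1).toAffineMap

theorem IsPiecewiseLinear.const_mul {f : X → ℝ} (hf : IsPiecewiseLinear f) (c : ℝ) :
    IsPiecewiseLinear (fun x => c * f x) := by
  simpa using hf.affine_comp (c • (LinearMap.id : ℝ →ₗ[ℝ] ℝ)).toAffineMap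

theorem IsPiecewiseLinear.sub {f g : X → ℝ} (hf : IsPiecewiseLinear f)
    (hg : IsPiecewiseLinear g) : IsPiecewiseLinear (fun x => f x - g x) := by
  simpa [sub_eq_add_neg] using hf.add (hg.const_mul (-1))

/-- Each polyhedron of the cover is cut in two by the sign of the affine map that represents `f` on
it. -/
theorem IsPiecewiseLinear.abs {f : X → ℝ} (hf : IsPiecewiseLinear f) :
    IsPiecewiseLinear (fun x => |f x|) := by
  obtain ⟨P, h1, h2, h3, h4⟩ := hf
  choose! A hA using h4
  refine ⟨(fun C => C ∩ {x | 0 ≤ A C x}) '' P ∪ (fun C => C ∩ {x | 0 ≤ (-A C) x}) '' P,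
    (h1.image _).union (h1.image _), ?_, ?_, ?_⟩
  · rintro _ (⟨C, hC, rfl⟩ | ⟨C, hC, rfl⟩) <;> exact (h2 C hC).inter_halfSpace _
  · intro x hx
    obtain ⟨C, hC, hxC⟩ := h3 hx
    rcases le_total 0 (A C x) with h | h
    · exact ⟨_, Or.inl ⟨C, hC, rfl⟩, hxC, h⟩
    · exact ⟨_, Or.inr ⟨C, hC, rfl⟩, hxC, by simpa using h⟩
  · rintro _ (⟨C, hC, rfl⟩ | ⟨C, hC, rfl⟩)
    · refine ⟨A C, fun x hx => ?_⟩
      change |f x| = _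
      rw [hA C hC x hx.1, abs_of_nonneg hx.2]
    · refine ⟨-A C, fun x hx => ?_⟩
      have : A C x ≤ 0 := by simpa using hx.2
      change |f x| = _
      rw [hA C hC x hx.1, abs_of_nonpos this]
      rfl

theorem IsPiecewiseLinear.apply {ι : Type*} {X : Set (ι → ℝ)} (i : ι) :
    IsPiecewiseLinear (fun x : X => (x : ι → ℝ) i) :=
  IsPiecewiseLinear.of_affine (LinearMap.proj (R := ℝ) (φ := fun _ : ι => ℝ) i).toAffineMap

theorem IsPiecewiseLinear.circleX {s t : X → ℝ} (hs : IsPiecewiseLinear s)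
    (ht : IsPiecewiseLinear t) : IsPiecewiseLinear (fun x => circleX (s x) (t x)) :=
  (ht.sub (hs.const_mul 2)).abs.sub hs

theorem IsPiecewiseLinear.circleY {s t : X → ℝ} (hs : IsPiecewiseLinear s)
    (ht : IsPiecewiseLinear t) : IsPiecewiseLinear (fun x => circleY (s x) (t x)) :=
  ((ht.sub (hs.const_mul 2)).sub (ht.sub hs).abs).add (ht.sub (hs.const_mul 3)).abs

theorem IsPiecewiseLinear.sectorPos (n c : ℕ) {a b : X → ℝ} (ha : IsPiecewiseLinear a)
    (hb : IsPiecewiseLinear b) : IsPiecewiseLinear (fun x => sectorPos n c (a x) (b x)) := by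
  have := (((ha.add hb).const_mul c).add ha).const_mul (4 / n)
  refine (congrArg IsPiecewiseLinear (funext fun x => ?_)).mp this
  unfold _root_.sectorPos
  ring

end PiecewiseLinear

/-! ### Cross-polytopes and Euclidean balls -/

/-- The ℓ¹-ball is a bounded convex body with interior, so a homeomorphism of the whole space
carries it to the round ball and its frontier to the round sphere. A single map thus serves both
cases. -/
theorem exists_homeomorph_image_plBall (N : ℕ) :
    ∃ h : (Fin N → ℝ) ≃ₜ EuclideanSpace ℝ (Fin N),
      h '' {x | ∑ i, |x i| ≤ 1} = Metric.closedBall 0 1 ∧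
      h '' {x | ∑ i, |x i| = 1} = Metric.sphere 0 1 := by
  let L₁ : (Fin N → ℝ) ≃ₜ PiLp 1 (fun _ : Fin N => ℝ) :=
    (PiLp.continuousLinearEquiv 1 ℝ (fun _ : Fin N => ℝ)).symm.toHomeomorph
  let K := (PiLp.continuousLinearEquiv 1 ℝ (fun _ : Fin N => ℝ)).trans
    (PiLp.continuousLinearEquiv 2 ℝ (fun _ : Fin N => ℝ)).symm
  let L₂ : PiLp 1 (fun _ : Fin N => ℝ) ≃ₜ EuclideanSpace ℝ (Fin N) := K.toHomeomorph
  have hn : ∀ x, ‖L₁ x‖ = ∑ i, |x i| := by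
    intro x
    rw [PiLp.norm_eq_of_L1]
    rfl
  have hball : L₁ '' {x | ∑ i, |x i| ≤ 1} = Metric.closedBall 0 1 := by
    rw [L₁.image_eq_preimage_symm]
    ext y
    have := hn (L₁.symm y)
    rw [L₁.apply_symm_apply] at this
    simp [← this]
  have hsph : L₁ '' {x | ∑ i, |x i| = 1} = Metric.sphere 0 1 := by
    rw [L₁.image_eq_preimage_symm]
    ext y
    have := hn (L₁.symm y)
    rw [L₁.apply_symm_apply] at this
    simp [← this]
  obtain ⟨g, -, hg, hg'⟩ := exists_homeomorph_image_interior_closure_frontier_eq_unitBall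
    (s := L₂ '' Metric.closedBall 0 1)
    ((convex_closedBall 0 1).linear_image (K : PiLp 1 (fun _ : Fin N => ℝ) →ₗ[ℝ] EuclideanSpace ℝ (Fin N)))
    (by rw [← L₂.image_interior]
        exact Set.Nonempty.image _
          ⟨0, mem_interior_iff_mem_nhds.2 (Metric.closedBall_mem_nhds 0 one_pos)⟩)
    ((isCompact_closedBall 0 1).image L₂.continuous).isBounded
  refine ⟨(L₁.trans L₂).trans g, ?_, ?_⟩
  · rw [← hg, ← L₂.image_closure, Metric.isClosed_closedBall.closure_eq, ← hball,
      Set.image_image, Set.image_image]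
    rfl
  · rw [← hg', ← L₂.image_frontier, frontier_closedBall _ one_ne_zero, ← hsph,
      Set.image_image, Set.image_image]
    rfl

theorem nonempty_homeomorph_plBall (N : ℕ) :
    Nonempty (plBall N ≃ₜ Metric.closedBall (0 : EuclideanSpace ℝ (Fin N)) 1) := by
  obtain ⟨h, h1, -⟩ := exists_homeomorph_image_plBall N
  exact ⟨(h.image _).trans (Homeomorph.setCongr h1)⟩

theorem nonempty_homeomorph_plSphere (N : ℕ) :
    Nonempty (plSphere N ≃ₜ Metric.sphere (0 : EuclideanSpace ℝ (Fin (N + 1))) 1) := by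
  obtain ⟨h, -, h1⟩ := exists_homeomorph_image_plBall (N + 1)
  exact ⟨(h.image _).trans (Homeomorph.setCongr h1)⟩

/-! ### Coordinates grouped in pairs -/

/-- The coordinates `0, …, N - 1` grouped into `k` consecutive pairs and `m` remaining ones. -/
def coordEquiv {N k m : ℕ} (h : N = k * 2 + m) : (Fin k × Fin 2) ⊕ Fin m ≃ Fin N :=
  (Equiv.sumCongr finProdFinEquiv (Equiv.refl _)).trans (finSumFinEquiv.trans (finCongr h.symm))

theorem coordEquiv_inl {N k m : ℕ} (h : N = k * 2 + m) (p : Fin k × Fin 2) :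
    (coordEquiv h (Sum.inl p) : ℕ) = 2 * p.1 + p.2 := by
  simp [coordEquiv, finProdFinEquiv, add_comm]

theorem coordEquiv_inr {N k m : ℕ} (h : N = k * 2 + m) (r : Fin m) :
    (coordEquiv h (Sum.inr r) : ℕ) = 2 * k + r := by
  simp [coordEquiv, mul_comm]

theorem sum_coordEquiv {N k m : ℕ} (h : N = k * 2 + m) (f : Fin N → ℝ) :
    ∑ j, f j = ∑ i : Fin k, (f (coordEquiv h (Sum.inl (i, 0))) + f (coordEquiv h (Sum.inl (i, 1)))) +
      ∑ r, f (coordEquiv h (Sum.inr r)) := by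
  rw [← (coordEquiv h).sum_comp f, Fintype.sum_sum_type, Fintype.sum_prod_type]
  simp only [Fin.sum_univ_two]

/-- The vertex `2 i`. -/
abbrev evenVertex {d k : ℕ} (hk : 2 * k ≤ d) (i : Fin k) : Fin (d + 1) := ⟨2 * i, by omega⟩

/-- The vertex `2 i + 1`. -/
abbrev oddVertex {d k : ℕ} (hk : 2 * k ≤ d) (i : Fin k) : Fin (d + 1) := ⟨2 * i + 1, by omega⟩

/-- The vertex `d - 1`. -/
abbrev penultimateVertex (d : ℕ) : Fin (d + 1) := ⟨d - 1, by omega⟩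

/-- The vertex `d`. -/
abbrev lastVertex (d : ℕ) : Fin (d + 1) := ⟨d, by omega⟩

theorem sum_vertices {d k : ℕ} (hk : 2 * k ≤ d) (hd : d = 2 * k + 1) (f : Fin (d + 1) → ℝ) :
    ∑ j, f j = ∑ i : Fin k, (f (evenVertex hk i) + f (oddVertex hk i)) +
      (f (penultimateVertex d) + f (lastVertex d)) := by
  have h : d + 1 = k * 2 + 2 := by omega
  rw [sum_coordEquiv h, Fin.sum_univ_two]
  congr! 4 with i <;>
  · apply Fin.ext
    simp only [coordEquiv_inl, coordEquiv_inr, Fin.val_zero, Fin.val_one] <;> omega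

/-- Each pair of coordinates `(x_{2i}, x_{2i+1})`, wrapped around the plane. -/
def planar {d k : ℕ} (hk : 2 * k ≤ d) (x : Fin (d + 1) → ℝ) (p : Fin k × Fin 2) : ℝ :=
  ![circleX (x (evenVertex hk p.1) + x (oddVertex hk p.1)) (4 * x (evenVertex hk p.1)),
    circleY (x (evenVertex hk p.1) + x (oddVertex hk p.1)) (4 * x (evenVertex hk p.1))] p.2

section planar

variable {d k : ℕ} (hk : 2 * k ≤ d)

theorem sum_abs_planar {x : Fin (d + 1) → ℝ} (hx : ∀ j, 0 ≤ x j) :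
    ∑ i, (|planar hk x (i, 0)| + |planar hk x (i, 1)|) =
      ∑ i, (x (evenVertex hk i) + x (oddVertex hk i)) := by
  refine Finset.sum_congr rfl fun i _ => ?_
  have h1 := hx (evenVertex hk i)
  have h2 := hx (oddVertex hk i)
  exact abs_circleX_add_abs_circleY (by linarith) (by linarith)

/-- The relation generated on pairs of coordinates by `(a, 0) ∼ (0, a)`. -/
def PairRel (x y : Fin (d + 1) → ℝ) (i : Fin k) : Prop :=
  (x (evenVertex hk i) = y (evenVertex hk i) ∧ x (oddVertex hk i) = y (oddVertex hk i)) ∨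
  ((x (evenVertex hk i) = 0 ∨ x (oddVertex hk i) = 0) ∧
    x (evenVertex hk i) = y (oddVertex hk i) ∧ x (oddVertex hk i) = y (evenVertex hk i))

theorem pairRel_of_planar_eq {x y : Fin (d + 1) → ℝ} (hx : ∀ j, 0 ≤ x j) (hy : ∀ j, 0 ≤ y j)
    (h : planar hk x = planar hk y) (i : Fin k) : PairRel hk x y i :=
  pair_injective (hx _) (hx _) (hy _) (hy _) (congrFun h (i, 0)) (congrFun h (i, 1))

theorem planar_congr {x y : Fin (d + 1) → ℝ}
    (h : ∀ i : Fin k, x (evenVertex hk i) = y (evenVertex hk i) ∧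
      x (oddVertex hk i) = y (oddVertex hk i)) : planar hk x = planar hk y := by
  funext p
  simp only [planar, (h p.1).1, (h p.1).2]

/-- Each planar point is lifted separately. The lifts preserve ℓ¹-norms, which is why the
coordinates sum to 1. -/
theorem planar_surjective (hd : d = 2 * k + 1) (z : Fin k × Fin 2 → ℝ) {a b : ℝ} (ha : 0 ≤ a)
    (hb : 0 ≤ b) (h : ∑ i, (|z (i, 0)| + |z (i, 1)|) + (a + b) = 1) :
    ∃ x ∈ stdSimplex ℝ (Fin (d + 1)), planar hk x = z ∧ x (penultimateVertex d) = a ∧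
      x (lastVertex d) = b := by
  choose u v hu hv huv hX hY using fun i => pair_surjective (z (i, 0)) (z (i, 1))
  have h' : d + 1 = k * 2 + 2 := by omega
  let x : Fin (d + 1) → ℝ := fun j =>
    Sum.elim (fun p : Fin k × Fin 2 => ![u p.1, v p.1] p.2) ![a, b] ((coordEquiv h').symm j)
  have e0 : ∀ i, x (evenVertex hk i) = u i := by
    intro i
    have : evenVertex hk i = coordEquiv h' (Sum.inl (i, 0)) := Fin.ext (by simp [coordEquiv_inl])
    simp [x, this]
  have e1 : ∀ i, x (oddVertex hk i) = v i := by
    intro i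
    have : oddVertex hk i = coordEquiv h' (Sum.inl (i, 1)) := Fin.ext (by simp [coordEquiv_inl])
    simp [x, this]
  have e2 : x (penultimateVertex d) = a := by
    have : penultimateVertex d = coordEquiv h' (Sum.inr 0) :=
      Fin.ext (by simp [coordEquiv_inr]; omega)
    simp [x, this]
  have e3 : x (lastVertex d) = b := by
    have : lastVertex d = coordEquiv h' (Sum.inr 1) := Fin.ext (by simp [coordEquiv_inr]; omega)
    simp [x, this]
  refine ⟨x, ⟨fun j => ?_, ?_⟩, ?_, e2, e3⟩
  · obtain ⟨(⟨i, r⟩ | r), rfl⟩ := (coordEquiv h').surjective j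
    · simp only [x, Equiv.symm_apply_apply, Sum.elim_inl]
      fin_cases r
      · exact hu i
      · exact hv i
    · simp only [x, Equiv.symm_apply_apply, Sum.elim_inr]
      fin_cases r
      · exact ha
      · exact hb
  · rw [sum_vertices hk hd, e2, e3, ← h]
    simp only [e0, e1, huv]
  · funext ⟨i, r⟩
    simp only [planar, e0, e1]
    fin_cases r
    · exact hX i
    · exact hY i

theorem continuous_planar (p : Fin k × Fin 2) : Continuous fun x => planar hk x p := by
  obtain ⟨i, r⟩ := p
  unfold planar
  fin_cases r
  · change Continuous fun x : Fin (d + 1) → ℝ => circleX _ _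
    unfold circleX
    fun_prop
  · change Continuous fun x : Fin (d + 1) → ℝ => circleY _ _
    unfold circleY
    fun_prop

theorem isPiecewiseLinear_planar (X : Set (Fin (d + 1) → ℝ)) (p : Fin k × Fin 2) :
    IsPiecewiseLinear fun x : X => planar hk x p := by
  obtain ⟨i, r⟩ := p
  unfold planar
  fin_cases r
  · exact ((IsPiecewiseLinear.apply _).add (.apply _)).circleX ((IsPiecewiseLinear.apply _).const_mul 4)
  · exact ((IsPiecewiseLinear.apply _).add (.apply _)).circleY ((IsPiecewiseLinear.apply _).const_mul 4)

end planar

/-! ### Points identified by folding -/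

/-- The point obtained by interchanging two barycentric coordinates. -/
def swapPoint {N : ℕ} (a b : Fin N) (x : stdSimplex ℝ (Fin N)) : stdSimplex ℝ (Fin N) :=
  ⟨fun j => x.1 (Equiv.swap a b j), fun _ => x.2.1 _,
    (Equiv.sum_comp (Equiv.swap a b) x.1).trans x.2.2⟩

theorem swapPoint_left {N : ℕ} (a b : Fin N) (x : stdSimplex ℝ (Fin N)) :
    (swapPoint a b x).1 a = x.1 b := by
  simp [swapPoint]

theorem swapPoint_right {N : ℕ} (a b : Fin N) (x : stdSimplex ℝ (Fin N)) :
    (swapPoint a b x).1 b = x.1 a := by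
  simp [swapPoint]

theorem swapPoint_of_ne {N : ℕ} {a b j : Fin N} (ha : j ≠ a) (hb : j ≠ b)
    (x : stdSimplex ℝ (Fin N)) : (swapPoint a b x).1 j = x.1 j := by
  simp [swapPoint, Equiv.swap_apply_of_ne_of_ne ha hb]

theorem swapPoint_swapPoint {N : ℕ} (a b : Fin N) (x : stdSimplex ℝ (Fin N)) :
    swapPoint a b (swapPoint a b x) = x := by
  apply Subtype.ext
  funext j
  simp [swapPoint]

theorem swapPoint_eq_self {N : ℕ} {a b : Fin N} {x : stdSimplex ℝ (Fin N)} (h : x.1 a = x.1 b) :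
    swapPoint a b x = x := by
  apply Subtype.ext
  funext j
  rcases eq_or_ne j a with rfl | ha
  · rw [swapPoint_left, h]
  rcases eq_or_ne j b with rfl | hb
  · rw [swapPoint_right, h]
  exact swapPoint_of_ne ha hb x

/-- Carries an identification between consecutive copies all the way round the cycle. -/
theorem apply_eq_of_finRotate {n : ℕ} {α : Type*} {f : Fin n → α}
    (h : ∀ c, f c = f (finRotate n c)) (c c' : Fin n) : f c = f c' := by
  obtain ⟨m, rfl⟩ : ∃ m, n = m + 1 := ⟨n - 1, by have := c.2; omega⟩
  have h0 : ∀ c, f c = f 0 := by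
    intro c
    induction c using Fin.induction with
    | zero => rfl
    | succ i ih => rw [← ih, h i.castSucc, finRotate_apply, Fin.coeSucc_eq_succ]
  rw [h0 c, h0 c']

namespace GenTriangulation

variable {d : ℕ}

/-- `fold` is a restriction of a transposition, so the gluing is the interchange of two coordinates
of the whole point. -/
theorem fold_glued_iff (a b : Fin (d + 1)) (x y : stdSimplex ℝ (Fin (d + 1))) :
    (x.1 b = 0 ∧ y.1 a = 0 ∧ ∀ j : {j : Fin (d + 1) // j ≠ b}, y.1 (fold a b j) = x.1 j) ↔
      x.1 b = 0 ∧ y = swapPoint a b x := by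
  have key : ∀ j, (fold a b j : Fin (d + 1)) = Equiv.swap a b j := fun _ => rfl
  constructor
  · rintro ⟨hx, hy, h⟩
    refine ⟨hx, Subtype.ext (funext fun j => ?_)⟩
    change y.1 j = x.1 (Equiv.swap a b j)
    rcases eq_or_ne j a with rfl | hj
    · rw [Equiv.swap_apply_left, hx, hy]
    · have h1 : Equiv.swap a b j ≠ b := fun h => hj (by
        rwa [Equiv.swap_apply_eq_iff, Equiv.swap_apply_right] at h)
      have h2 := h ⟨_, h1⟩
      rwa [key, Equiv.swap_apply_self] at h2
  · rintro ⟨hx, rfl⟩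
    refine ⟨hx, by rw [swapPoint_left, hx], fun j => ?_⟩
    simp [key, swapPoint]

/-- Induction on the set of pairs in which the points may differ: one fold corrects one pair without
disturbing the others. -/
theorem charMap_eq_of_pairRel (T : GenTriangulation d) (Δ : T.Facet) {k : ℕ} (hk : 2 * k ≤ d)
    (hT : ∀ (i : Fin k) (x : stdSimplex ℝ (Fin (d + 1))), x.1 (oddVertex hk i) = 0 →
      T.charMap Δ x = T.charMap Δ (swapPoint (evenVertex hk i) (oddVertex hk i) x))
    (s : Finset (Fin k)) (x y : stdSimplex ℝ (Fin (d + 1)))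
    (h1 : ∀ i ∈ s, PairRel hk x.1 y.1 i)
    (h2 : ∀ j, (∀ i ∈ s, j ≠ evenVertex hk i ∧ j ≠ oddVertex hk i) → x.1 j = y.1 j) :
    T.charMap Δ x = T.charMap Δ y := by
  induction s using Finset.induction_on generalizing x with
  | empty =>
    rw [show x = y from Subtype.ext (funext fun j => h2 j (by simp))]
  | insert i s his ih =>
    -- The interchange is an involution, so the fold can be used from either of its two ridges.
    have hT' : ∀ x : stdSimplex ℝ (Fin (d + 1)),
        x.1 (evenVertex hk i) = 0 ∨ x.1 (oddVertex hk i) = 0 →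
        T.charMap Δ x = T.charMap Δ (swapPoint (evenVertex hk i) (oddVertex hk i) x) := by
      rintro x (h | h)
      · have := hT i (swapPoint (evenVertex hk i) (oddVertex hk i) x) (by rw [swapPoint_right, h])
        rw [swapPoint_swapPoint] at this
        exact this.symm
      · exact hT i x h
    have hrest : ∀ z : stdSimplex ℝ (Fin (d + 1)),
        z.1 (evenVertex hk i) = y.1 (evenVertex hk i) → z.1 (oddVertex hk i) = y.1 (oddVertex hk i) →
        (∀ j, j ≠ evenVertex hk i → j ≠ oddVertex hk i → z.1 j = x.1 j) →
        T.charMap Δ z = T.charMap Δ y := by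
      intro z he ho hz
      refine ih z (fun i' hi' => ?_) fun j hj => ?_
      · have hne : (i' : ℕ) ≠ i := fun h => his (Fin.ext h ▸ hi')
        have := h1 i' (Finset.mem_insert_of_mem hi')
        unfold PairRel at this ⊢
        rwa [hz (evenVertex hk i') (by simpa [Fin.ext_iff] using hne)
            (by simp [Fin.ext_iff]; omega),
          hz (oddVertex hk i') (by simp [Fin.ext_iff]; omega)
            (by simpa [Fin.ext_iff] using hne)]
      · rcases eq_or_ne j (evenVertex hk i) with rfl | hje
        · exact he
        rcases eq_or_ne j (oddVertex hk i) with rfl | hjo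
        · exact ho
        rw [hz j hje hjo]
        refine h2 j fun i' hi' => ?_
        rcases Finset.mem_insert.1 hi' with rfl | hi'
        · exact ⟨hje, hjo⟩
        · exact hj i' hi'
    rcases h1 i (Finset.mem_insert_self _ _) with h | ⟨h0, h, h'⟩
    · exact hrest x h.1 h.2 fun _ _ _ => rfl
    · rw [hT' x h0]
      refine hrest _ ?_ ?_ fun j hje hjo => swapPoint_of_ne hje hjo x
      · rw [swapPoint_left, h']
      · rw [swapPoint_right, h]

/-- If all pairs of coordinates are related and the last two coordinates agree, then the points are
identified. -/
theorem charMap_eq_of_planar_eq (T : GenTriangulation d) (Δ : T.Facet) {k : ℕ} (hk : 2 * k ≤ d)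
    (hd : d = 2 * k + 1)
    (hT : ∀ (i : Fin k) (x : stdSimplex ℝ (Fin (d + 1))), x.1 (oddVertex hk i) = 0 →
      T.charMap Δ x = T.charMap Δ (swapPoint (evenVertex hk i) (oddVertex hk i) x))
    {x y : stdSimplex ℝ (Fin (d + 1))} (h : planar hk x.1 = planar hk y.1)
    (h1 : x.1 (penultimateVertex d) = y.1 (penultimateVertex d))
    (h2 : x.1 (lastVertex d) = y.1 (lastVertex d)) :
    T.charMap Δ x = T.charMap Δ y := by
  refine T.charMap_eq_of_pairRel Δ hk hT Finset.univ x y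
    (fun i _ => pairRel_of_planar_eq hk x.2.1 y.2.1 h i) fun j hj => ?_
  have hj' : ∀ i : ℕ, i < k → (j : ℕ) ≠ 2 * i ∧ (j : ℕ) ≠ 2 * i + 1 := fun i hi => by
    simpa [Fin.ext_iff] using hj ⟨i, hi⟩ (Finset.mem_univ _)
  have hjk : 2 * k ≤ (j : ℕ) := by
    by_contra hlt
    have := hj' (j / 2) (by omega)
    omega
  rcases (show (j : ℕ) = d - 1 ∨ (j : ℕ) = d by omega) with h | h
  · rwa [show j = penultimateVertex d from Fin.ext h]
  · rwa [show j = lastVertex d from Fin.ext h]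

/-- Well-definedness under a fold: (a, 0) and (0, a) sit at positions 4a and 0, the two ends of the
circle of radius a. -/
theorem planar_swapPoint {k : ℕ} (hk : 2 * k ≤ d) (i : Fin k) {x : stdSimplex ℝ (Fin (d + 1))}
    (hx : x.1 (oddVertex hk i) = 0) :
    planar hk (swapPoint (evenVertex hk i) (oddVertex hk i) x).1 = planar hk x.1 := by
  have h0 := x.2.1 (evenVertex hk i)
  funext ⟨i', r⟩
  rcases eq_or_ne i' i with rfl | hne
  · simp only [planar, swapPoint_left, swapPoint_right, hx, mul_zero, add_zero, zero_add,
      circle_zero h0, circle_four_mul h0]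
  · have hne' : (i' : ℕ) ≠ i := fun h => hne (Fin.ext h)
    simp only [planar]
    rw [swapPoint_of_ne (by simpa [Fin.ext_iff] using hne') (by simp [Fin.ext_iff]; omega),
      swapPoint_of_ne (by simp [Fin.ext_iff]; omega) (by simpa [Fin.ext_iff] using hne')]

theorem swapPoint_apply_penultimate {k : ℕ} (hk : 2 * k ≤ d) (hd : d = 2 * k + 1) (i : Fin k)
    (x : stdSimplex ℝ (Fin (d + 1))) :
    (swapPoint (evenVertex hk i) (oddVertex hk i) x).1 (penultimateVertex d) =
      x.1 (penultimateVertex d) :=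
  swapPoint_of_ne (by simp [Fin.ext_iff]; omega) (by simp [Fin.ext_iff]; omega) x

theorem swapPoint_apply_last {k : ℕ} (hk : 2 * k ≤ d) (hd : d = 2 * k + 1) (i : Fin k)
    (x : stdSimplex ℝ (Fin (d + 1))) :
    (swapPoint (evenVertex hk i) (oddVertex hk i) x).1 (lastVertex d) = x.1 (lastVertex d) :=
  swapPoint_of_ne (by simp [Fin.ext_iff]; omega) (by simp [Fin.ext_iff]; omega) x

theorem planar_swapPoint_last {k : ℕ} (hk : 2 * k ≤ d) (hd : d = 2 * k + 1)
    (x : stdSimplex ℝ (Fin (d + 1))) :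
    planar hk (swapPoint (penultimateVertex d) (lastVertex d) x).1 = planar hk x.1 :=
  planar_congr hk fun i =>
    ⟨swapPoint_of_ne (by simp [Fin.ext_iff]; omega) (by simp [Fin.ext_iff]; omega) x,
      swapPoint_of_ne (by simp [Fin.ext_iff]; omega) (by simp [Fin.ext_iff]; omega) x⟩

/-! ### Recognising the underlying space -/

/-- Finitely many simplices have a compact quotient, so a continuous bijection onto a Hausdorff set
is a homeomorphism. -/
theorem exists_homeomorph_of_charMap (T : GenTriangulation d) [Finite T.Facet] {N : ℕ}
    {Y : Set (Fin N → ℝ)} (F : T.Facet → stdSimplex ℝ (Fin (d + 1)) → Fin N → ℝ)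
    (hc : ∀ Δ, Continuous (F Δ)) (hY : ∀ Δ x, F Δ x ∈ Y)
    (hg : ∀ p q : T.Pieces, T.GluedPoints p q → F p.1 p.2 = F q.1 q.2)
    (hi : ∀ Δ x Δ' x', F Δ x = F Δ' x' → T.charMap Δ x = T.charMap Δ' x')
    (hs : ∀ y ∈ Y, ∃ Δ x, F Δ x = y) :
    ∃ h : T.Space ≃ₜ Y, ∀ Δ x, (h (T.charMap Δ x) : Fin N → ℝ) = F Δ x := by
  let f : T.Space → Y := Quot.lift (fun p => ⟨F p.1 p.2, hY _ _⟩)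
    fun p q h => Subtype.ext (hg p q h)
  have hf : Continuous f :=
    continuous_quot_lift _ (continuous_sigma fun Δ => (hc Δ).subtype_mk _)
  have hinj : Function.Injective f := by
    rintro ⟨p⟩ ⟨q⟩ h
    exact hi _ _ _ _ (congrArg Subtype.val h)
  have hsurj : Function.Surjective f := by
    rintro ⟨y, hy⟩
    obtain ⟨Δ, x, h⟩ := hs y hy
    exact ⟨T.charMap Δ x, Subtype.ext h⟩
  exact ⟨Continuous.homeoOfEquivCompactToT2 (f := Equiv.ofBijective f ⟨hinj, hsurj⟩) hf,
    fun _ _ => rfl⟩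

end GenTriangulation

namespace GenTriangulation

variable {d : ℕ}

/-! ### The snapped ball -/

theorem snappedBall_gluedPoints_iff {k : ℕ} (hk : 2 * k ≤ d) (p q : (snappedBall d k hk).Pieces) :
    (snappedBall d k hk).GluedPoints p q ↔ ∃ i : Fin k, p.2.1 (oddVertex hk i) = 0 ∧
      q.2 = swapPoint (evenVertex hk i) (oddVertex hk i) p.2 := by
  constructor
  · rintro ⟨i, -, -, h⟩
    exact ⟨i, (fold_glued_iff _ _ _ _).1 h⟩
  · rintro ⟨i, h⟩
    exact ⟨i, rfl, rfl, (fold_glued_iff _ _ _ _).2 h⟩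

/-- The map from the simplex onto the cross-polytope that realises the snapped ball. -/
def ballMap {k : ℕ} (hk : 2 * k ≤ d) (hd : d = k * 2 + 1) (x : Fin (d + 1) → ℝ) (j : Fin d) : ℝ :=
  Sum.elim (planar hk x) (fun _ => x (penultimateVertex d) - x (lastVertex d))
    ((coordEquiv hd).symm j)

theorem ballMap_inl {k : ℕ} (hk : 2 * k ≤ d) (hd : d = k * 2 + 1) (x : Fin (d + 1) → ℝ)
    (p : Fin k × Fin 2) : ballMap hk hd x (coordEquiv hd (Sum.inl p)) = planar hk x p := by
  simp [ballMap]

theorem ballMap_inr {k : ℕ} (hk : 2 * k ≤ d) (hd : d = k * 2 + 1) (x : Fin (d + 1) → ℝ)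
    (r : Fin 1) : ballMap hk hd x (coordEquiv hd (Sum.inr r)) =
      x (penultimateVertex d) - x (lastVertex d) := by
  simp [ballMap]

theorem sum_abs_ballMap {k : ℕ} (hk : 2 * k ≤ d) (hd : d = k * 2 + 1)
    (x : stdSimplex ℝ (Fin (d + 1))) :
    ∑ j, |ballMap hk hd x.1 j| = 1 - (x.1 (penultimateVertex d) + x.1 (lastVertex d)) +
      |x.1 (penultimateVertex d) - x.1 (lastVertex d)| := by
  rw [sum_coordEquiv hd]
  simp only [ballMap_inl, ballMap_inr, Fin.sum_univ_one]
  have h := sum_vertices hk (by omega) x.1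
  rw [x.2.2] at h
  rw [sum_abs_planar hk x.2.1]
  linarith

theorem snappedBall_exists_homeomorph {k : ℕ} (hk : 2 * k ≤ d) (hd : d = k * 2 + 1) :
    ∃ h : (snappedBall d k hk).Space ≃ₜ plBall d, ∀ Δ x,
      (h ((snappedBall d k hk).charMap Δ x) : Fin d → ℝ) = ballMap hk hd x.1 := by
  have : Finite (snappedBall d k hk).Facet := inferInstanceAs (Finite Unit)
  have hd' : d = 2 * k + 1 := by omega
  have hT : ∀ Δ (i : Fin k) (x : stdSimplex ℝ (Fin (d + 1))), x.1 (oddVertex hk i) = 0 →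
      (snappedBall d k hk).charMap Δ x =
        (snappedBall d k hk).charMap Δ (swapPoint (evenVertex hk i) (oddVertex hk i) x) :=
    fun Δ i x hx => Quot.sound ((snappedBall_gluedPoints_iff hk _ _).2 ⟨i, hx, rfl⟩)
  refine exists_homeomorph_of_charMap _ (fun _ x => ballMap hk hd x.1) (fun _ => ?_) (fun _ x => ?_)
    (fun p q hpq => ?_) (fun Δ x Δ' y h => ?_) (fun y hy => ?_)
  · refine continuous_pi fun j => Continuous.comp (g := fun x => ballMap hk hd x j) ?_
      continuous_subtype_val
    obtain ⟨(p | r), rfl⟩ := (coordEquiv hd).surjective j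
    · simp only [ballMap_inl]
      exact continuous_planar hk p
    · simp only [ballMap_inr]
      fun_prop
  · change ∑ j, |ballMap hk hd x.1 j| ≤ 1
    rw [sum_abs_ballMap]
    have h1 := x.2.1 (penultimateVertex d)
    have h2 := x.2.1 (lastVertex d)
    grind
  · obtain ⟨i, hi, hq⟩ := (snappedBall_gluedPoints_iff hk p q).1 hpq
    funext j
    rw [hq]
    simp only [ballMap, planar_swapPoint hk i hi, swapPoint_apply_penultimate hk hd',
      swapPoint_apply_last hk hd']
  · have h1 : planar hk x.1 = planar hk y.1 := by
      funext p
      simpa only [ballMap_inl] using congrFun h (coordEquiv hd (Sum.inl p))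
    have h2 : x.1 (penultimateVertex d) - x.1 (lastVertex d) =
        y.1 (penultimateVertex d) - y.1 (lastVertex d) := by
      simpa only [ballMap_inr] using congrFun h (coordEquiv hd (Sum.inr 0))
    -- The planar part fixes the sum of the last two coordinates; together with their difference
    -- this fixes both.
    have h3 := sum_vertices hk hd' x.1
    have h4 := sum_vertices hk hd' y.1
    rw [x.2.2, ← sum_abs_planar hk x.2.1, h1] at h3
    rw [y.2.2, ← sum_abs_planar hk y.2.1] at h4
    obtain rfl : Δ = Δ' := rfl
    exact charMap_eq_of_planar_eq _ Δ hk hd' (hT Δ) h1 (by linarith) (by linarith)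
  · let z : Fin k × Fin 2 → ℝ := fun p => y (coordEquiv hd (Sum.inl p))
    let t : ℝ := y (coordEquiv hd (Sum.inr 0))
    change ∑ j, |y j| ≤ 1 at hy
    rw [sum_coordEquiv hd, Fin.sum_univ_one] at hy
    let s : ℝ := 1 - ∑ i, (|z (i, 0)| + |z (i, 1)|)
    have hs : |t| ≤ s := by simp only [s, t, z]; linarith
    have hs' := abs_le.1 hs
    -- The last two coordinates must have sum `s`, the ℓ¹-norm not used by `z`, and difference `t`.
    obtain ⟨x, hx, h1, h2, h3⟩ := planar_surjective hk hd' z (a := (s + t) / 2) (b := (s - t) / 2)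
      (by linarith) (by linarith) (by simp only [s]; ring)
    refine ⟨(), ⟨x, hx⟩, funext fun j => ?_⟩
    obtain ⟨(p | r), rfl⟩ := (coordEquiv hd).surjective j
    · simp only [ballMap_inl, h1, z]
    · rw [Subsingleton.elim r 0]
      simp only [ballMap_inr, h2, h3]
      change _ = t
      ring

theorem snappedBall_isTriangulationOfBall {k : ℕ} (hk : 2 * k ≤ d) (hd : d = k * 2 + 1) :
    (snappedBall d k hk).IsTriangulationOfBall := by
  obtain ⟨h, hh⟩ := snappedBall_exists_homeomorph hk hd
  refine ⟨(nonempty_homeomorph_plBall d).map h.trans, h, fun Δ => ?_⟩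
  refine IsPiecewiseLinear.pi fun j => ?_
  simp only [hh]
  obtain ⟨(p | r), rfl⟩ := (coordEquiv hd).surjective j
  · simp only [ballMap_inl]
    exact isPiecewiseLinear_planar hk _ p
  · simp only [ballMap_inr]
    exact (IsPiecewiseLinear.apply _).sub (.apply _)

/-! ### The snapped sphere -/

theorem two_mul_half_le (d : ℕ) : 2 * ((d - 1) / 2) ≤ d := by omega

theorem snappedSphere_gluedPoints_iff {n : ℕ} (hd : Odd d) (p q : (snappedSphere d n hd).Pieces) :
    (snappedSphere d n hd).GluedPoints p q ↔
      (p.1 = q.1 ∧ ∃ i : Fin ((d - 1) / 2), p.2.1 (oddVertex (two_mul_half_le d) i) = 0 ∧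
        q.2 = swapPoint (evenVertex (two_mul_half_le d) i) (oddVertex (two_mul_half_le d) i) p.2) ∨
      (q.1 = (finRotate n p.1.1, ()) ∧ p.2.1 (lastVertex d) = 0 ∧
        q.2 = swapPoint (penultimateVertex d) (lastVertex d) p.2) := by
  constructor
  · rintro ⟨⟨c, i⟩ | c, h1, h2, h⟩
    · exact Or.inl ⟨h1.trans h2.symm, i, (fold_glued_iff _ _ _ _).1 h⟩
    · exact Or.inr ⟨by rw [h1]; exact h2, (fold_glued_iff _ _ _ _).1 h⟩
  · rintro (⟨h1, i, h⟩ | ⟨h1, h⟩)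
    · exact ⟨Sum.inl (p.1.1, i), rfl, h1.symm, (fold_glued_iff _ _ _ _).2 h⟩
    · exact ⟨Sum.inr p.1.1, rfl, h1, (fold_glued_iff _ _ _ _).2 h⟩

/-- The map from the `c`-th simplex to the boundary of the cross-polytope that realises the snapped
sphere. -/
noncomputable def sphereMap (n : ℕ) {k : ℕ} (hk : 2 * k ≤ d) (hd : d + 1 = k * 2 + 2) (c : ℕ)
    (x : Fin (d + 1) → ℝ) (j : Fin (d + 1)) : ℝ :=
  Sum.elim (planar hk x)
    ![circleX (x (penultimateVertex d) + x (lastVertex d))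
        (sectorPos n c (x (penultimateVertex d)) (x (lastVertex d))),
      circleY (x (penultimateVertex d) + x (lastVertex d))
        (sectorPos n c (x (penultimateVertex d)) (x (lastVertex d)))]
    ((coordEquiv hd).symm j)

section sphereMap

variable {n k : ℕ} (hk : 2 * k ≤ d) (hd : d + 1 = k * 2 + 2) (c : ℕ) (x : Fin (d + 1) → ℝ)

theorem sphereMap_inl (p : Fin k × Fin 2) :
    sphereMap n hk hd c x (coordEquiv hd (Sum.inl p)) = planar hk x p := by
  simp [sphereMap]

theorem sphereMap_inr_zero :
    sphereMap n hk hd c x (coordEquiv hd (Sum.inr 0)) =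
      circleX (x (penultimateVertex d) + x (lastVertex d))
        (sectorPos n c (x (penultimateVertex d)) (x (lastVertex d))) := by
  simp [sphereMap]

theorem sphereMap_inr_one :
    sphereMap n hk hd c x (coordEquiv hd (Sum.inr 1)) =
      circleY (x (penultimateVertex d) + x (lastVertex d))
        (sectorPos n c (x (penultimateVertex d)) (x (lastVertex d))) := by
  simp [sphereMap]

theorem continuous_sphereMap : Continuous (sphereMap n hk hd c) := by
  refine continuous_pi fun j => ?_
  obtain ⟨(p | r), rfl⟩ := (coordEquiv hd).surjective j
  · simp only [sphereMap_inl]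
    exact continuous_planar hk p
  · fin_cases r
    · simp only [Fin.zero_eta, sphereMap_inr_zero, circleX, sectorPos]
      fun_prop
    · simp only [Fin.mk_one, sphereMap_inr_one, circleY, sectorPos]
      fun_prop

theorem isPiecewiseLinear_sphereMap (X : Set (Fin (d + 1) → ℝ)) :
    IsPiecewiseLinear fun x : X => sphereMap n hk hd c x := by
  refine IsPiecewiseLinear.pi fun j => ?_
  obtain ⟨(p | r), rfl⟩ := (coordEquiv hd).surjective j
  · simp only [sphereMap_inl]
    exact isPiecewiseLinear_planar hk _ p
  · fin_cases r
    · simp only [Fin.zero_eta, sphereMap_inr_zero]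
      exact ((IsPiecewiseLinear.apply _).add (.apply _)).circleX
        ((IsPiecewiseLinear.apply _).sectorPos n c (.apply _))
    · simp only [Fin.mk_one, sphereMap_inr_one]
      exact ((IsPiecewiseLinear.apply _).add (.apply _)).circleY
        ((IsPiecewiseLinear.apply _).sectorPos n c (.apply _))

theorem sum_abs_sphereMap (hc : c < n) (x : stdSimplex ℝ (Fin (d + 1))) :
    ∑ j, |sphereMap n hk hd c x.1 j| = 1 := by
  have h1 := x.2.1 (penultimateVertex d)
  have h2 := x.2.1 (lastVertex d)
  rw [sum_coordEquiv hd, Fin.sum_univ_two]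
  simp only [sphereMap_inl, sphereMap_inr_zero, sphereMap_inr_one]
  have h := sum_vertices hk (by omega) x.1
  rw [x.2.2] at h
  rw [sum_abs_planar hk x.2.1, abs_circleX_add_abs_circleY (sectorPos_nonneg h1 h2)
    (sectorPos_le hc h1 h2), h]

end sphereMap

theorem snappedSphere_exists_homeomorph {n : ℕ} (hd : Odd d) (hn : 0 < n)
    (hd' : d + 1 = (d - 1) / 2 * 2 + 2) :
    ∃ h : (snappedSphere d n hd).Space ≃ₜ plSphere d, ∀ Δ x,
      (h ((snappedSphere d n hd).charMap Δ x) : Fin (d + 1) → ℝ) =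
        sphereMap n (two_mul_half_le d) hd' Δ.1 x.1 := by
  have : Finite (snappedSphere d n hd).Facet := inferInstanceAs (Finite (Fin n × Unit))
  have hk := two_mul_half_le d
  have hdk : d = 2 * ((d - 1) / 2) + 1 := by omega
  have hT : ∀ Δ (i : Fin ((d - 1) / 2)) (x : stdSimplex ℝ (Fin (d + 1))),
      x.1 (oddVertex hk i) = 0 → (snappedSphere d n hd).charMap Δ x =
        (snappedSphere d n hd).charMap Δ (swapPoint (evenVertex hk i) (oddVertex hk i) x) :=
    fun Δ i x hx => Quot.sound ((snappedSphere_gluedPoints_iff hd _ _).2 (.inl ⟨rfl, i, hx, rfl⟩))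
  have hR : ∀ (c : Fin n) (x : stdSimplex ℝ (Fin (d + 1))), x.1 (lastVertex d) = 0 →
      (snappedSphere d n hd).charMap (c, ()) x = (snappedSphere d n hd).charMap (finRotate n c, ())
        (swapPoint (penultimateVertex d) (lastVertex d) x) :=
    fun c x hx => Quot.sound ((snappedSphere_gluedPoints_iff hd _ _).2 (.inr ⟨rfl, hx, rfl⟩))
  -- Such a point lies on both cyclically glued ridges of its copy and is fixed by the interchange,
  -- so all its copies coincide.
  have hapex : ∀ (c c' : Fin n) (x : stdSimplex ℝ (Fin (d + 1))),
      x.1 (penultimateVertex d) = 0 → x.1 (lastVertex d) = 0 →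
      (snappedSphere d n hd).charMap (c, ()) x = (snappedSphere d n hd).charMap (c', ()) x := by
    intro c c' x h0 h1
    refine apply_eq_of_finRotate (f := fun c => (snappedSphere d n hd).charMap (c, ()) x)
      (fun c => ?_) c c'
    have := hR c x h1
    rwa [swapPoint_eq_self (h0.trans h1.symm)] at this
  have hstep : ∀ (c : Fin n) (x y : stdSimplex ℝ (Fin (d + 1))),
      planar hk x.1 = planar hk y.1 → x.1 (lastVertex d) = 0 → y.1 (penultimateVertex d) = 0 →
      x.1 (penultimateVertex d) = y.1 (lastVertex d) →
      (snappedSphere d n hd).charMap (c, ()) x =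
        (snappedSphere d n hd).charMap (finRotate n c, ()) y := by
    intro c x y h hx hy hxy
    rw [hR c x hx]
    refine charMap_eq_of_planar_eq _ _ hk hdk (hT _) ?_ ?_ ?_
    · rw [planar_swapPoint_last hk hdk, h]
    · rw [swapPoint_left, hx, hy]
    · rw [swapPoint_right, hxy]
  refine exists_homeomorph_of_charMap _
    (fun (Δ : (snappedSphere d n hd).Facet) x => sphereMap n (two_mul_half_le d) hd' Δ.1 x.1)
    (fun Δ => ?_) (fun Δ x => ?_) (fun p q hpq => ?_) ?_ (fun y hy => ?_)
  · exact (continuous_sphereMap _ _ _).comp continuous_subtype_val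
  · exact sum_abs_sphereMap hk hd' _ Δ.1.2 x
  · rcases (snappedSphere_gluedPoints_iff hd p q).1 hpq with ⟨h, i, hi, hq⟩ | ⟨h, hp, hq⟩
    · funext j
      rw [hq, h]
      simp only [sphereMap, planar_swapPoint hk i hi, swapPoint_apply_penultimate hk hdk,
        swapPoint_apply_last hk hdk]
    · funext j
      have hrot := sectorPos_finRotate p.1.1 (p.2.2.1 (penultimateVertex d))
      rw [hq, h]
      simp only [sphereMap, planar_swapPoint_last hk hdk, swapPoint_left, swapPoint_right, hp,
        add_zero, zero_add, hrot.1, hrot.2]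
  · rintro ⟨c, ⟨⟩⟩ x ⟨c', ⟨⟩⟩ y h
    have h1 : planar hk x.1 = planar hk y.1 := by
      funext p
      simpa only [sphereMap_inl] using congrFun h (coordEquiv hd' (Sum.inl p))
    have h2 := congrFun h (coordEquiv hd' (Sum.inr 0))
    have h3 := congrFun h (coordEquiv hd' (Sum.inr 1))
    simp only [sphereMap_inr_zero] at h2
    simp only [sphereMap_inr_one] at h3
    -- In order: same copy, both points at the apex, second copy next after the first, first copy
    -- next after the second.
    rcases sector_injective (x.2.1 _) (x.2.1 _) (y.2.1 _) (y.2.1 _) h2 h3 with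
      ⟨rfl, h4, h5⟩ | ⟨h4, h5, h6, h7⟩ | ⟨rfl, h4, h5, h6⟩ | ⟨rfl, h4, h5, h6⟩
    · exact charMap_eq_of_planar_eq _ _ hk hdk (hT _) h1 h4 h5
    · rw [hapex c c' x h4 h5]
      exact charMap_eq_of_planar_eq _ _ hk hdk (hT _) h1 (h4.trans h6.symm) (h5.trans h7.symm)
    · exact hstep c x y h1 h4 h5 h6
    · exact (hstep c' y x h1.symm h4 h5 h6).symm
  · let z : Fin ((d - 1) / 2) × Fin 2 → ℝ := fun p => y (coordEquiv hd' (Sum.inl p))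
    change ∑ j, |y j| = 1 at hy
    rw [sum_coordEquiv hd', Fin.sum_univ_two] at hy
    obtain ⟨c, a, b, ha, hb, hab, hX, hY⟩ := sector_surjective hn
      (y (coordEquiv hd' (Sum.inr 0))) (y (coordEquiv hd' (Sum.inr 1)))
    obtain ⟨x, hx, h1, h2, h3⟩ := planar_surjective hk hdk z ha hb (by rw [hab]; exact hy)
    refine ⟨(c, ()), ⟨x, hx⟩, funext fun j => ?_⟩
    obtain ⟨(p | r), rfl⟩ := (coordEquiv hd').surjective j
    · simp only [sphereMap_inl, h1, z]
    · fin_cases r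
      · simp only [Fin.zero_eta, sphereMap_inr_zero, h2, h3]
        exact hX
      · simp only [Fin.mk_one, sphereMap_inr_one, h2, h3]
        exact hY

theorem snappedSphere_isTriangulationOfSphere {n : ℕ} (hd : Odd d) (hn : 0 < n) :
    (snappedSphere d n hd).IsTriangulationOfSphere := by
  obtain ⟨h, hh⟩ := snappedSphere_exists_homeomorph hd hn (by obtain ⟨m, rfl⟩ := hd; omega)
  refine ⟨(nonempty_homeomorph_plSphere d).map h.trans, h, fun Δ => ?_⟩
  simp only [hh]
  exact isPiecewiseLinear_sphereMap _ _ _ _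

/-! ### Face numbers and the dual graph -/

/-- A d-face contains every vertex, in particular the one opposite any given ridge, so no two
d-faces are ever related. -/
theorem fNumber_top (T : GenTriangulation d) : T.fNumber d = Nat.card T.Facet := by
  have huniv : ∀ p : T.PreFace d, p.2.1 = Finset.univ := fun p =>
    Finset.card_eq_iff_eq_univ _ |>.1 (by rw [p.2.2, Fintype.card_fin])
  refine Nat.card_congr
    { toFun := Quot.lift (fun p => p.1) fun p q ⟨g, _, _, h, _⟩ =>
        (h (huniv p ▸ Finset.mem_univ _)).elim
      invFun := fun Δ => Quot.mk _ (Δ, ⟨Finset.univ, by simp⟩)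
      left_inv := ?_
      right_inv := fun _ => rfl }
  rintro ⟨p⟩
  exact congrArg (Quot.mk _) (Prod.ext rfl (Subtype.ext (huniv p).symm))

/-- The vertex `v` of the facet `Δ`, as a face of dimension `0`. -/
def preVertex (T : GenTriangulation d) (Δ : T.Facet) (v : Fin (d + 1)) : T.PreFace 0 :=
  (Δ, ⟨{v}, Finset.card_singleton v⟩)

theorem exists_preVertex (T : GenTriangulation d) (p : T.PreFace 0) :
    ∃ v, p = T.preVertex p.1 v := by
  obtain ⟨v, hv⟩ := Finset.card_eq_one.1 p.2.2
  exact ⟨v, Prod.ext rfl (Subtype.ext hv)⟩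

theorem fold_gluedFaces_iff (a b v w : Fin (d + 1)) :
    (b ∉ ({v} : Finset (Fin (d + 1))) ∧ a ∉ ({w} : Finset (Fin (d + 1))) ∧
      ∀ j : {j : Fin (d + 1) // j ≠ b},
        (fold a b j : Fin (d + 1)) ∈ ({w} : Finset (Fin (d + 1))) ↔
          (j : Fin (d + 1)) ∈ ({v} : Finset (Fin (d + 1)))) ↔
      v ≠ b ∧ w = Equiv.swap a b v := by
  have key : ∀ j, (fold a b j : Fin (d + 1)) = Equiv.swap a b j := fun _ => rfl
  simp only [Finset.mem_singleton, key]
  constructor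
  · rintro ⟨h1, -, h⟩
    exact ⟨Ne.symm h1, ((h ⟨v, Ne.symm h1⟩).2 rfl).symm⟩
  · rintro ⟨h1, rfl⟩
    refine ⟨Ne.symm h1, fun h => h1 ?_, fun j => (Equiv.swap a b).apply_eq_iff_eq⟩
    rwa [eq_comm, Equiv.swap_apply_eq_iff, Equiv.swap_apply_left] at h

theorem snappedSphere_gluedFaces_iff {n : ℕ} (hd : Odd d) (c c' : Fin n) (v w : Fin (d + 1)) :
    (snappedSphere d n hd).GluedFaces 0 ((snappedSphere d n hd).preVertex (c, ()) v)
      ((snappedSphere d n hd).preVertex (c', ()) w) ↔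
      (c = c' ∧ ∃ i : Fin ((d - 1) / 2), v ≠ oddVertex (two_mul_half_le d) i ∧
        w = Equiv.swap (evenVertex (two_mul_half_le d) i) (oddVertex (two_mul_half_le d) i) v) ∨
      (c' = finRotate n c ∧ v ≠ lastVertex d ∧
        w = Equiv.swap (penultimateVertex d) (lastVertex d) v) := by
  constructor
  · rintro ⟨⟨c₀, i⟩ | c₀, h1, h2, h⟩
    · have h1' : c = c₀ := congrArg Prod.fst h1
      have h2' : c' = c₀ := congrArg Prod.fst h2
      exact Or.inl ⟨h1'.trans h2'.symm, i, (fold_gluedFaces_iff _ _ _ _).1 h⟩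
    · have h1' : c = c₀ := congrArg Prod.fst h1
      have h2' : c' = finRotate n c₀ := congrArg Prod.fst h2
      exact Or.inr ⟨h1' ▸ h2', (fold_gluedFaces_iff _ _ _ _).1 h⟩
  · rintro (⟨rfl, i, h⟩ | ⟨rfl, h⟩)
    · exact ⟨Sum.inl (c, i), rfl, rfl, (fold_gluedFaces_iff _ _ _ _).2 h⟩
    · exact ⟨Sum.inr c, rfl, rfl, (fold_gluedFaces_iff _ _ _ _).2 h⟩

/-- The class of the vertex `v` of the `c`-th facet of the snapped sphere. -/
def vertexClass {n : ℕ} (c : Fin n) (v : Fin (d + 1)) : Fin n ⊕ Fin ((d - 1) / 2) :=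
  if h : (v : ℕ) / 2 < (d - 1) / 2 then Sum.inr ⟨v / 2, h⟩
  else if (v : ℕ) = d then Sum.inl c else Sum.inl (finRotate n c)

theorem vertexClass_of_lt {n : ℕ} (c : Fin n) {v : Fin (d + 1)} (h : (v : ℕ) / 2 < (d - 1) / 2) :
    vertexClass c v = Sum.inr ⟨v / 2, h⟩ := dif_pos h

theorem vertexClass_last {n : ℕ} (hd : Odd d) (c : Fin n) :
    vertexClass c (lastVertex d) = Sum.inl c := by
  obtain ⟨m, rfl⟩ := hd
  rw [vertexClass, dif_neg (by simp; omega), if_pos rfl]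

/-- The index is that of the next copy, whose vertex d is glued to this one. -/
theorem vertexClass_penultimate {n : ℕ} (hd : Odd d) (c : Fin n) :
    vertexClass c (penultimateVertex d) = Sum.inl (finRotate n c) := by
  obtain ⟨m, rfl⟩ := hd
  rw [vertexClass, dif_neg (by simp), if_neg (by simp)]

theorem vertex_cases (hd : Odd d) (v : Fin (d + 1)) :
    (∃ i : Fin ((d - 1) / 2), v = evenVertex (two_mul_half_le d) i) ∨
    (∃ i : Fin ((d - 1) / 2), v = oddVertex (two_mul_half_le d) i) ∨
      v = penultimateVertex d ∨ v = lastVertex d := by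
  obtain ⟨m, rfl⟩ := hd
  simp only [Fin.ext_iff]
  by_cases h : (v : ℕ) / 2 < m
  · rcases Nat.even_or_odd' (v : ℕ) with ⟨i, hi | hi⟩
    · exact Or.inl ⟨⟨i, by omega⟩, hi⟩
    · exact Or.inr (Or.inl ⟨⟨i, by omega⟩, hi⟩)
  · omega

theorem vertexClass_eq_of_glued {n : ℕ} (hd : Odd d) {c c' : Fin n} {v w : Fin (d + 1)}
    (h : (snappedSphere d n hd).GluedFaces 0 ((snappedSphere d n hd).preVertex (c, ()) v)
      ((snappedSphere d n hd).preVertex (c', ()) w)) : vertexClass c v = vertexClass c' w := by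
  rcases (snappedSphere_gluedFaces_iff hd c c' v w).1 h with ⟨rfl, i, -, rfl⟩ | ⟨rfl, hv, rfl⟩
  · have hi : 2 * (i : ℕ) / 2 < (d - 1) / 2 := by omega
    have hi' : (2 * (i : ℕ) + 1) / 2 < (d - 1) / 2 := by omega
    rcases eq_or_ne v (evenVertex (two_mul_half_le d) i) with rfl | h1
    · rw [Equiv.swap_apply_left, vertexClass_of_lt (v := evenVertex _ i) c hi,
        vertexClass_of_lt (v := oddVertex _ i) c hi']
      simp only [Sum.inr.injEq, Fin.mk.injEq]
      omega
    rcases eq_or_ne v (oddVertex (two_mul_half_le d) i) with rfl | h2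
    · rw [Equiv.swap_apply_right, vertexClass_of_lt (v := evenVertex _ i) c hi,
        vertexClass_of_lt (v := oddVertex _ i) c hi']
      simp only [Sum.inr.injEq, Fin.mk.injEq]
      omega
    rw [Equiv.swap_apply_of_ne_of_ne h1 h2]
  · rcases eq_or_ne v (penultimateVertex d) with rfl | h1
    · rw [Equiv.swap_apply_left, vertexClass_penultimate hd, vertexClass_last hd]
    · rw [Equiv.swap_apply_of_ne_of_ne h1 hv]
      have h1' : (v : ℕ) ≠ d - 1 := fun h => h1 (Fin.ext h)
      have hv' : (v : ℕ) ≠ d := fun h => hv (Fin.ext h)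
      have hlt : (v : ℕ) / 2 < (d - 1) / 2 := by obtain ⟨m, rfl⟩ := hd; omega
      rw [vertexClass_of_lt c hlt, vertexClass_of_lt _ hlt]

/-- A normal form, making `vertexClass` a complete invariant: the cyclic gluings fix 0, …, d - 2, so
even vertices below d - 1 can be moved to the base copy `c₀`, and odd ones below d are first folded
onto even ones. -/
theorem mk_preVertex_eq {n : ℕ} (hd : Odd d) (c₀ c : Fin n) (v : Fin (d + 1)) :
    (Quot.mk _ ((snappedSphere d n hd).preVertex (c, ()) v) :
        Quot ((snappedSphere d n hd).GluedFaces 0)) =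
      Sum.elim (fun c => Quot.mk _ ((snappedSphere d n hd).preVertex (c, ()) (lastVertex d)))
        (fun i => Quot.mk _ ((snappedSphere d n hd).preVertex (c₀, ())
          (evenVertex (two_mul_half_le d) i))) (vertexClass c v) := by
  have hne : ∀ i : Fin ((d - 1) / 2),
      evenVertex (two_mul_half_le d) i ≠ lastVertex d ∧
        evenVertex (two_mul_half_le d) i ≠ penultimateVertex d := by
    intro i
    obtain ⟨m, rfl⟩ := hd
    simp only [ne_eq, Fin.mk.injEq]
    omega
  have heven : ∀ i : Fin ((d - 1) / 2),
      (Quot.mk _ ((snappedSphere d n hd).preVertex (c, ()) (evenVertex (two_mul_half_le d) i)) :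
        Quot ((snappedSphere d n hd).GluedFaces 0)) = Quot.mk _
          ((snappedSphere d n hd).preVertex (c₀, ()) (evenVertex (two_mul_half_le d) i)) := by
    intro i
    refine apply_eq_of_finRotate (f := fun c => (Quot.mk _ ((snappedSphere d n hd).preVertex (c, ())
      (evenVertex (two_mul_half_le d) i)) : Quot ((snappedSphere d n hd).GluedFaces 0)))
      (fun c => Quot.sound ?_) c c₀
    exact (snappedSphere_gluedFaces_iff hd _ _ _ _).2 (.inr ⟨rfl, (hne i).1,
      (Equiv.swap_apply_of_ne_of_ne (hne i).2 (hne i).1).symm⟩)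
  rcases vertex_cases hd v with ⟨i, rfl⟩ | ⟨i, rfl⟩ | rfl | rfl
  · have hi : 2 * (i : ℕ) / 2 < (d - 1) / 2 := by omega
    have hi' : (⟨2 * (i : ℕ) / 2, hi⟩ : Fin ((d - 1) / 2)) = i := Fin.ext (by simp)
    rw [vertexClass_of_lt c hi, Sum.elim_inr, hi', heven i]
  · have hi : (2 * (i : ℕ) + 1) / 2 < (d - 1) / 2 := by omega
    have hi' : (⟨(2 * (i : ℕ) + 1) / 2, hi⟩ : Fin ((d - 1) / 2)) = i := Fin.ext (by simp; omega)
    rw [vertexClass_of_lt c hi, Sum.elim_inr, hi', ← heven i]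
    refine (Quot.sound ((snappedSphere_gluedFaces_iff hd _ _ _ _).2
      (.inl ⟨rfl, i, ?_, (Equiv.swap_apply_left _ _).symm⟩))).symm
    simp
  · rw [vertexClass_penultimate hd, Sum.elim_inl]
    refine Quot.sound ((snappedSphere_gluedFaces_iff hd _ _ _ _).2
      (.inr ⟨rfl, ?_, (Equiv.swap_apply_left _ _).symm⟩))
    have := hd.pos
    simp only [ne_eq, Fin.mk.injEq]
    omega
  · rw [vertexClass_last hd, Sum.elim_inl]

theorem snappedSphere_fNumber_zero {n : ℕ} (hd : Odd d) (hn : 0 < n) :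
    (snappedSphere d n hd).fNumber 0 = n + (d - 1) / 2 := by
  choose vert hvert using (snappedSphere d n hd).exists_preVertex
  let f : Quot ((snappedSphere d n hd).GluedFaces 0) → Fin n ⊕ Fin ((d - 1) / 2) :=
    Quot.lift (fun p => vertexClass p.1.1 (vert p)) fun p q h =>
      vertexClass_eq_of_glued hd (by rw [hvert p, hvert q] at h; exact h)
  have hf : ∀ (c : Fin n) v, f (Quot.mk _ ((snappedSphere d n hd).preVertex (c, ()) v)) =
      vertexClass c v := by
    intro c v
    have h := congrArg (fun p => p.2.1) (hvert ((snappedSphere d n hd).preVertex (c, ()) v))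
    have h' : v = vert ((snappedSphere d n hd).preVertex (c, ()) v) := Finset.singleton_injective h
    change vertexClass c (vert _) = _
    rw [← h']
  have hinj : Function.Injective f := by
    rintro ⟨p⟩ ⟨q⟩ h
    rw [hvert p, hvert q] at h ⊢
    obtain ⟨⟨c, ⟨⟩⟩, s⟩ := p
    obtain ⟨⟨c', ⟨⟩⟩, s'⟩ := q
    rw [hf, hf] at h
    rw [mk_preVertex_eq hd ⟨0, hn⟩ c, mk_preVertex_eq hd ⟨0, hn⟩ c', h]
  have hsurj : Function.Surjective f := by
    rintro (c | i)
    · exact ⟨Quot.mk _ ((snappedSphere d n hd).preVertex (c, ()) (lastVertex d)),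
        (hf c (lastVertex d)).trans (vertexClass_last hd c)⟩
    · have hi : 2 * (i : ℕ) / 2 < (d - 1) / 2 := by omega
      refine ⟨Quot.mk _ ((snappedSphere d n hd).preVertex (⟨0, hn⟩, ())
        (evenVertex (two_mul_half_le d) i)), (hf ⟨0, hn⟩ (evenVertex (two_mul_half_le d) i)).trans
        ((vertexClass_of_lt _ hi).trans ?_)⟩
      simp
  rw [fNumber, Nat.card_congr (Equiv.ofBijective f ⟨hinj, hsurj⟩)]
  simp

/-- Folds are the loops and cyclic gluings the sides. Both graphs define "next" by `finRotate`, so n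
= 1 and n = 2 need no separate treatment. -/
theorem snappedSphere_dualGraph {n : ℕ} (hd : Odd d) :
    GraphIsomorphic (snappedSphere d n hd).dualGraph (loopedPolygon n ((d - 1) / 2)) := by
  have hE : ∀ g, g ∈ E((snappedSphere d n hd).dualGraph) := fun g => ⟨_, _, rfl⟩
  have hE' : ∀ g, g ∈ E(loopedPolygon n ((d - 1) / 2)) := by
    rintro (c | p)
    · exact ⟨_, _, rfl⟩
    · exact ⟨_, _, rfl⟩
  let φ : V((snappedSphere d n hd).dualGraph) ≃ V(loopedPolygon n ((d - 1) / 2)) :=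
    (Equiv.Set.univ (Fin n × Unit)).trans
      ((Equiv.prodPUnit (Fin n)).trans (Equiv.Set.univ (Fin n)).symm)
  let ψ : E((snappedSphere d n hd).dualGraph) ≃ E(loopedPolygon n ((d - 1) / 2)) :=
    (Equiv.subtypeUnivEquiv hE).trans ((Equiv.sumComm (Fin n × Fin ((d - 1) / 2)) (Fin n)).trans
      (Equiv.subtypeUnivEquiv hE').symm)
  have hφ : ∀ (a b : Fin n) (x y : Fin n × Unit),
      s((a, ()), (b, ())) = s(x, y) ↔ s(a, b) = s(x.1, y.1) := by
    rintro a b ⟨x, ⟨⟩⟩ ⟨y, ⟨⟩⟩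
    simp
  refine ⟨φ, ψ, ?_⟩
  rintro ⟨p | c, he⟩ x y
  · exact hφ p.1 p.1 x.1 y.1
  · exact hφ c (finRotate n c) x.1 y.1

end GenTriangulation

theorem mainTheorem4 (d n : ℕ) (hd : Odd d) (hn : 0 < n) :
    (GenTriangulation.snappedBall d ((d - 1) / 2) (by omega)).IsTriangulationOfBall ∧
    (GenTriangulation.snappedSphere d n hd).IsTriangulationOfSphere ∧
    (GenTriangulation.snappedSphere d n hd).fNumber d = n ∧
    (GenTriangulation.snappedSphere d n hd).fNumber 0 = n + (d - 1) / 2 ∧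
    GraphIsomorphic (GenTriangulation.snappedSphere d n hd).dualGraph
      (loopedPolygon n ((d - 1) / 2)) := by
  refine ⟨GenTriangulation.snappedBall_isTriangulationOfBall _ (by obtain ⟨m, rfl⟩ := hd; omega),
    GenTriangulation.snappedSphere_isTriangulationOfSphere hd hn, ?_,
    GenTriangulation.snappedSphere_fNumber_zero hd hn, GenTriangulation.snappedSphere_dualGraph hd⟩
  rw [GenTriangulation.fNumber_top]
  change Nat.card (Fin n × Unit) = n
  simp
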